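/- Let $\mathcal G$ be a connected metric graph with finitely many vertices and finitely many edges, each edge $\mathrm e$ being identified with an interval $I_{\mathrm e}=[0,\ell_{\mathrm e}]$ or $I_{\mathrm e}=[0,+\infty)$ ($\mathcal G$ need not be compact; loops and multiple edges are allowed). Let $H^1(\mathcal G)$ be the space of continuous $u:\mathcal G\to\mathbb R$ whose restriction $u_{\mathrm e}$ to every edge lies in $H^1(I_{\mathrm e})$, with $\|u\|_{H^1}^2=\sum_{\mathrm e}\big(\|u_{\mathrm e}'\|_{L^2}^2+\|u_{\mathrm e}\|_{L^2}^2\big)$. Let $p>6$, $\mu>0$, $\bar k\in\mathbb N$, and for $\rho\in\mathbb R$ put $$E_\rho(u)=\frac12\int_{\mathcal G}|u'|^2\,dx-\frac{\rho}{p}\int_{\mathcal G}|u|^p\,dx,\qquad H^1_\mu(\mathcal G)=\Big\{u\in H^1(\mathcal G):\int_{\mathcal G}|u|^2\,dx=\mu\Big\}.$$ Let $\rho_n\to1$ and $\lambda_n$ be real sequences and let $u_n\in H^1(\mathcal G)$, of class $C^2$ on every closed edge, satisfy, for every $n$, $$-u_n''+\lambda_n u_n=\rho_n u_n^{p-1}\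 \text{ on every edge},\qquad u_n>0\ \text{ on }\mathcal G,\qquad \sum_{\mathrm e\succ\mathrm v}u_{\mathrm e,n}'(\mathrm v)=0\ \text{ at every vertex }\mathrm v,$$ where the sum runs over the edge-ends incident at $\mathrm v$ and the derivatives are taken in the outgoing direction. Suppose that $\int_{\mathcal G}|u_n|^2\,dx=\mu$ and $m(u_n)\le\bar k$ for all $n$, where the Morse index $m(u_n)$ is the maximal dimension of a subspace $W$ of the compactly supported functions in $H^1(\mathcal G)$ such that $$\int_{\mathcal G}\Big(|\varphi'|^2+\big(\lambda_n-(p-1)\rho_n|u_n|^{p-2}\big)\varphi^2\Big)\,dx<0\qquad\text{for all }\varphi\in W\setminus\{0\},$$ and that the sequence $\{E_{\rho_n}(u_n)\}$ is bounded. Then $\{\lambda_n\}$ is bounded in $\mathbb R$, $\{u_n\}$ is bounded in $H^1(\mathcal G)$, and $\{u_n\}$ is a (bounded) Palais–Smale sequence for $E_1$ constrained to $H^1_\mu(\mathcal G)$; that is, $u_n\in H^1_\mu(\mathcal G)$, $\{E_1(u_n)\}$ is bounded, and $$\sup\Big\{|dE_1(u_n)[\varphi]| : \varphi\in H^1(\mathcal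 G),\ \int_{\mathcal G}u_n\varphi\,dx=0,\ \|\varphi\|_{H^1}\le1\Big\}\to0 .$$ -/

import Mathlib

open MeasureTheory Set Filter Topology

/-- Combinatorial and metric data of a metric graph with vertices `V`, bounded edges `B` and
half-lines `H`.  A bounded edge `b` is a copy of `[0, len b]` whose endpoints `0` and `len b` are
the vertices `src b` and `tgt b` (which may coincide); a half-line `h` is a copy of `[0, ∞)` whose
endpoint `0` is the vertex `root h`. -/
structure MetricGraph (V B H : Type*) where
  len : B → ℝ
  len_pos : ∀ b, 0 < len b
  src : B → V
  tgt : B → V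
  root : H → V

namespace MetricGraph

noncomputable section

variable {V B H : Type*} (G : MetricGraph V B H)

/-- The closed interval with which an edge is identified. -/
def interval : B ⊕ H → Set ℝ
  | .inl b => Icc 0 (G.len b)
  | .inr _ => Ici 0

/-- The vertex of an edge at coordinate `0`. -/
def origin : B ⊕ H → V
  | .inl b => G.src b
  | .inr h => G.root h

theorem zero_mem_interval (e : B ⊕ H) : (0 : ℝ) ∈ G.interval e := by
  cases e with
  | inl b => exact ⟨le_rfl, (G.len_pos b).le⟩
  | inr h => exact le_refl (0 : ℝ)

theorem len_mem_interval (b : B) : G.len b ∈ G.interval (.inl b) :=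
  ⟨(G.len_pos b).le, le_rfl⟩

/-- The identification of the endpoints of the edges with the vertices. -/
inductive Glue : V ⊕ (Σ e : B ⊕ H, G.interval e) → V ⊕ (Σ e : B ⊕ H, G.interval e) → Prop
  | atOrigin (e : B ⊕ H) : Glue (.inl (G.origin e)) (.inr ⟨e, ⟨0, G.zero_mem_interval e⟩⟩)
  | atEnd (b : B) : Glue (.inl (G.tgt b)) (.inr ⟨.inl b, ⟨G.len b, G.len_mem_interval b⟩⟩)

/-- The points of the metric graph: vertices and edges glued together. -/
def Point : Type _ := Quot G.Glue

/-- The quotient topology; the set of vertices is discrete. -/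
instance : TopologicalSpace G.Point :=
  letI : TopologicalSpace V := ⊥
  inferInstanceAs (TopologicalSpace (Quot G.Glue))

/-- The point of coordinate `t` on the edge `e`. -/
def pt (e : B ⊕ H) (t : G.interval e) : G.Point := Quot.mk _ (.inr ⟨e, t⟩)

open Classical in
/-- The component `u_e` of a function `u` on the graph, extended by zero outside of the interval
of the edge. -/
def comp (u : G.Point → ℝ) (e : B ⊕ H) (t : ℝ) : ℝ :=
  if h : t ∈ G.interval e then u (G.pt e ⟨t, h⟩) else 0

theorem comp_add (u v : G.Point → ℝ) (e : B ⊕ H) : G.comp (u + v) e = G.comp u e + G.comp v e := by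
  funext t
  by_cases h : t ∈ G.interval e <;> simp [comp, h]

theorem comp_smul (c : ℝ) (u : G.Point → ℝ) (e : B ⊕ H) : G.comp (c • u) e = c • G.comp u e := by
  funext t
  by_cases h : t ∈ G.interval e <;> simp [comp, h]

theorem comp_zero (e : B ⊕ H) : G.comp (0 : G.Point → ℝ) e = 0 := by
  funext t
  by_cases h : t ∈ G.interval e <;> simp [comp, h]

variable {G}

/-- Membership in the Sobolev space `H¹` of an interval `I`, for a function given pointwise:
`f` is locally absolutely continuous on `I`, and `f` and its (almost everywhere defined)
derivative are square integrable on `I`. -/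
def MemH1 (I : Set ℝ) (f : ℝ → ℝ) : Prop :=
  (∀ a ∈ I, ∀ b ∈ I, AbsolutelyContinuousOnInterval f a b) ∧
  MemLp f 2 (volume.restrict I) ∧ MemLp (deriv f) 2 (volume.restrict I)

theorem ae_differentiableAt_of_memH1 {e : B ⊕ H} {f : ℝ → ℝ} (hf : MemH1 (G.interval e) f) :
    ∀ᵐ t ∂volume.restrict (G.interval e), DifferentiableAt ℝ f t := by
  cases e with
  | inl b =>
    refine (ae_restrict_iff' measurableSet_Icc).2 ?_
    filter_upwards [(hf.1 _ (G.zero_mem_interval _) _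
      (G.len_mem_interval b)).ae_differentiableAt] with t ht hmem
    exact ht (by rwa [uIcc_of_le (G.len_pos b).le])
  | inr h =>
    refine (ae_restrict_iff' measurableSet_Ici).2 ?_
    have key : ∀ n : ℕ, ∀ᵐ t : ℝ, t ∈ uIcc (0 : ℝ) n → DifferentiableAt ℝ f t := fun n =>
      (hf.1 0 (le_refl (0 : ℝ)) n (Nat.cast_nonneg n : (0 : ℝ) ≤ n)).ae_differentiableAt
    filter_upwards [ae_all_iff.2 key] with t ht hmem
    obtain ⟨n, hn⟩ := exists_nat_ge t
    exact ht n (by rw [uIcc_of_le (Nat.cast_nonneg n)]; exact ⟨hmem, hn⟩)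

variable (G)

/-- The Sobolev space `H¹` of the graph: continuous functions on the graph whose component on
every edge belongs to `H¹` of the interval of the edge. -/
def H1 : Submodule ℝ (G.Point → ℝ) where
  carrier := {u | Continuous u ∧ ∀ e, MemH1 (G.interval e) (G.comp u e)}
  add_mem' := by
    rintro u v ⟨hu, hu'⟩ ⟨hv, hv'⟩
    refine ⟨hu.add hv, fun e => ?_⟩
    rw [comp_add]
    refine ⟨fun a ha b hb => ((hu' e).1 a ha b hb).add ((hv' e).1 a ha b hb),
      (hu' e).2.1.add (hv' e).2.1, ((hu' e).2.2.add (hv' e).2.2).ae_eq ?_⟩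
    filter_upwards [ae_differentiableAt_of_memH1 (hu' e),
      ae_differentiableAt_of_memH1 (hv' e)] with t h1 h2
    exact (deriv_add h1 h2).symm
  zero_mem' := by
    refine ⟨continuous_zero, fun e => ?_⟩
    rw [comp_zero]
    refine ⟨fun a _ b _ => ?_, MemLp.zero', ?_⟩
    · exact ((LipschitzWith.const (0 : ℝ)).lipschitzOnWith (s := uIcc a b)).absolutelyContinuousOnInterval
    · have : deriv (0 : ℝ → ℝ) = fun _ => 0 := by funext t; exact deriv_const t 0
      rw [this]
      exact MemLp.zero'
  smul_mem' := by
    rintro c u ⟨hu, hu'⟩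
    refine ⟨hu.const_smul c, fun e => ?_⟩
    rw [comp_smul]
    refine ⟨fun a ha b hb => ((hu' e).1 a ha b hb).const_smul c,
      (hu' e).2.1.const_smul c, ((hu' e).2.2.const_smul c).ae_eq ?_⟩
    filter_upwards [ae_differentiableAt_of_memH1 (hu' e)] with t h1
    exact (deriv_const_smul c h1).symm

variable {G} [Fintype B] [Fintype H]

/-- The mass `∫_G |u|²`. -/
def mass (u : G.H1) : ℝ := ∑ e, ∫ t in G.interval e, |G.comp u e t| ^ 2

/-- The norm of `H¹`. -/
def h1Norm (u : G.H1) : ℝ :=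
  √(∑ e, ((∫ t in G.interval e, |deriv (G.comp u e) t| ^ 2) +
    ∫ t in G.interval e, |G.comp u e t| ^ 2))

/-- The energy `E_ρ(u) = 1/2 ∫_G |u'|² - ρ/p ∫_G |u|^p`. -/
def energy (p ρ : ℝ) (u : G.H1) : ℝ :=
  (1 / 2) * (∑ e, ∫ t in G.interval e, |deriv (G.comp u e) t| ^ 2) -
    (ρ / p) * ∑ e, ∫ t in G.interval e, |G.comp u e t| ^ p

open Classical in
/-- The Kirchhoff condition: at every vertex the sum of the outgoing derivatives over all ends of
edges incident at it vanishes (a loop contributes both of its ends). -/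
def Kirchhoff (u : G.Point → ℝ) : Prop :=
  ∀ v : V,
    (∑ e : B ⊕ H, if G.origin e = v then derivWithin (G.comp u e) (G.interval e) 0 else 0) +
      (∑ b : B, if G.tgt b = v then
        -derivWithin (G.comp u (.inl b)) (G.interval (.inl b)) (G.len b) else 0) = 0

/-- `u` is a positive solution of `-u'' + lam u = ρ u^(p-1)` on every edge, with the Kirchhoff
condition at every vertex. -/
structure IsPositiveSolution (p lam ρ : ℝ) (u : G.Point → ℝ) : Prop where
  pos : ∀ x, 0 < u x
  contDiffOn : ∀ e, ContDiffOn ℝ 2 (G.comp u e) (G.interval e)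
  equation : ∀ e, ∀ t ∈ G.interval e,
    -derivWithin (derivWithin (G.comp u e) (G.interval e)) (G.interval e) t + lam * G.comp u e t =
      ρ * G.comp u e t ^ (p - 1)
  kirchhoff : Kirchhoff u

/-- The quadratic form `∫_G |φ'|² + (lam - (p-1) ρ |u|^(p-2)) φ²`. -/
def secondVariation (p lam ρ : ℝ) (u φ : G.H1) : ℝ :=
  ∑ e, ∫ t in G.interval e, (|deriv (G.comp φ e) t| ^ 2 +
    (lam - (p - 1) * ρ * |G.comp u e t| ^ (p - 2)) * G.comp φ e t ^ 2)

/-- The Morse index: the supremum of the dimensions of the subspaces of compactly supported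
functions in `H¹` on which the second variation is negative definite. -/
def morseIndex (p lam ρ : ℝ) (u : G.H1) : ℕ∞ :=
  ⨆ W : {W : Submodule ℝ G.H1 // ∀ φ ∈ W, HasCompactSupport (φ : G.Point → ℝ) ∧
      (φ ≠ 0 → secondVariation p lam ρ u φ < 0)},
    Cardinal.toENat (Module.rank ℝ W.1)

/-- `φ` is tangent at `u` to the sphere of functions with the same mass as `u`. -/
def IsTangent (u φ : G.H1) : Prop := ∑ e, ∫ t in G.interval e, G.comp u e t * G.comp φ e t = 0

/-- Palais–Smale sequences of a functional `F` on `H¹` constrained to `{u ∈ H¹ : mass u = μ}`: the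
values of `F` are bounded, and the norm of the differential of `F` at `u n`, restricted to the
tangent space of the constraint at `u n`, tends to zero. -/
def IsConstrainedPalaisSmale (F : G.H1 → ℝ) (μ : ℝ) (u : ℕ → G.H1) : Prop :=
  (∀ n, mass (u n) = μ) ∧
  (∃ C, ∀ n, |F (u n)| ≤ C) ∧
  ∀ ε > 0, ∀ᶠ n in atTop, ∀ φ : G.H1, IsTangent (u n) φ →
    ∃ d, HasLineDerivAt ℝ F d (u n) φ ∧ |d| ≤ ε * h1Norm φ

end

end MetricGraph

/-! Everything reduces to an upper bound on `lam`. The energy and the Nehari identity (the equation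
tested with `u` itself) are two linear relations between `∫|u'|²`, `∫|u|^p` and `lam * μ`. Solving
them for `∫|u'|²` shows that a bound on `lam` from above bounds `u` in `H¹`, and `∫|u'|² ≥ 0` bounds
`lam` from below.

For the upper bound, the first integral `u'²/2 - lam u²/2 + ρ u^p/p` is constant on each edge and
zero on half-lines. By the same two relations its integral over the graph is `E (p+2)/(p-2) - lam μ
(p-6)/(2(p-2))`. Since `p > 6`, for large `lam` this total is at most a negative multiple of `lam`,
so some bounded edge carries a constant `c` comparable to `-lam` (`exists_firstIntegral_le`). There
`lam u²/2 ≥ -c`, and `lam` cancels: `u ≥ δ` on the whole edge, with `δ` depending only on `p`, `μ`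
and the graph.

Such an edge forces a large Morse index (`eventually_le_morseIndex`). In the direction `u ψ`, with
`ψ` supported inside the edge, the second variation is `∫ u² ψ'² - (p-2) ρ ∫ u^p ψ²`
(`secondVariation_eq`). Testing the equation with `ψ²` and using `u ≥ δ` gives `ρ ∫ u^p ψ² ≥ lam δ²
∫ ψ² - M μ`, while `∫ u² ψ'² ≤ M μ`. Hence the form is negative for large `lam`, and `k + 1`
disjoint bumps contradict an index at most `k`.

Finally, on tangent directions the multiplier term vanishes and `dE_1(u)[φ] = (ρ - 1) ∫ u^(p-1) φ`,
which is small because `u` is bounded in `H¹`, hence in `L^∞`. -/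

/-! ### Sobolev embedding on intervals and on the graph. -/

/-- A Sobolev inequality on a bounded interval. -/
theorem AbsolutelyContinuousOnInterval.sq_le_integral {f : ℝ → ℝ} {a b x : ℝ} (hab : a < b)
    (hf : AbsolutelyContinuousOnInterval f a b)
    (hf' : IntegrableOn (fun t => |deriv f t| ^ 2) (Icc a b)) (hx : x ∈ Icc a b) :
    f x ^ 2 ≤ (1 + (b - a)⁻¹) *
      ((∫ t in Icc a b, |deriv f t| ^ 2) + ∫ t in Icc a b, |f t| ^ 2) := by
  have hcont : ContinuousOn f (Icc a b) := by simpa [uIcc_of_le hab.le] using hf.continuousOn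
  have hf2 : IntegrableOn (fun t => |f t| ^ 2) (Icc a b) :=
    (hcont.abs.pow 2).integrableOn_compact isCompact_Icc
  set R := (∫ t in Icc a b, |deriv f t| ^ 2) + ∫ t in Icc a b, |f t| ^ 2 with hR
  have hA : 0 ≤ ∫ t in Icc a b, |deriv f t| ^ 2 := integral_nonneg fun t => by positivity
  -- `f(x)² - f(s)² = ∫ 2 f f'`, and `2|f f'| ≤ f² + f'²`. Averaging over `s` then produces the
  -- factor `1 + 1/(b - a)`.
  have key : ∀ s ∈ Icc a b, f x ^ 2 ≤ R + |f s| ^ 2 := by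
    intro s hs
    have hsub : uIcc s x ⊆ uIcc a b := by
      rw [uIcc_of_le hab.le]; exact uIcc_subset_Icc hs hx
    have hsub' : uIoc s x ⊆ Icc a b := by
      rw [uIcc_of_le hab.le] at hsub; exact uIoc_subset_uIcc.trans hsub
    have hfs := hf.mono hsub
    have h1 := hfs.integral_deriv_mul_eq_sub hfs
    have h2 : |∫ t in s..x, deriv f t * f t + f t * deriv f t| ≤ R := by
      rw [hR, ← integral_add hf' hf2]
      rw [← Real.norm_eq_abs]
      refine (intervalIntegral.norm_integral_le_integral_norm_uIoc).trans ?_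
      refine (integral_mono_of_nonneg (ae_of_all _ fun t => by positivity)
        ((hf'.add hf2).mono_set hsub') (ae_of_all _ fun t => ?_)).trans
        (setIntegral_mono_set (hf'.add hf2) (ae_of_all _ fun t => ?_) hsub'.eventuallyLE)
      · simp only [Real.norm_eq_abs, Pi.add_apply, sq_abs]
        rw [abs_le]
        constructor <;> nlinarith [sq_nonneg (deriv f t + f t), sq_nonneg (deriv f t - f t)]
      · simp only [Pi.add_apply, Pi.zero_apply]; positivity
    rw [h1] at h2
    have := (abs_le.1 h2).2
    rw [sq_abs]; nlinarith
  have hint := setIntegral_mono_on (s := Icc a b) (f := fun _ => f x ^ 2)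
    (g := fun s => R + |f s| ^ 2) (μ := volume) (by simp)
    ((integrableOn_const (by simp)).add hf2) measurableSet_Icc key
  have hadd : ∫ s in Icc a b, (R + |f s| ^ 2) =
      (∫ _ in Icc a b, R) + ∫ s in Icc a b, |f s| ^ 2 :=
    integral_add (by simp) hf2
  rw [hadd] at hint
  simp only [integral_const, MeasurableSet.univ, measureReal_restrict_apply, univ_inter,
    Real.volume_real_Icc_of_le hab.le, smul_eq_mul] at hint
  have hba : 0 < b - a := sub_pos.2 hab
  have h3 : (b - a) * f x ^ 2 ≤ (b - a) * R + R := by linarith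
  calc f x ^ 2 = (b - a)⁻¹ * ((b - a) * f x ^ 2) := by field_simp
    _ ≤ (b - a)⁻¹ * ((b - a) * R + R) := by gcongr
    _ = _ := by field_simp

namespace MetricGraph

variable {V B H : Type*} {G : MetricGraph V B H}

theorem measurableSet_interval (e : B ⊕ H) : MeasurableSet (G.interval e) := by
  cases e with
  | inl b => exact measurableSet_Icc
  | inr h => exact measurableSet_Ici

theorem convex_interval (e : B ⊕ H) : Convex ℝ (G.interval e) := by
  cases e with
  | inl b => exact convex_Icc _ _
  | inr h => exact convex_Ici _

theorem uniqueDiffOn_interval (e : B ⊕ H) : UniqueDiffOn ℝ (G.interval e) := by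
  cases e with
  | inl b => exact uniqueDiffOn_Icc (G.len_pos b)
  | inr h => exact uniqueDiffOn_Ici _

theorem nonneg_of_mem_interval {e : B ⊕ H} {t : ℝ} (ht : t ∈ G.interval e) : 0 ≤ t := by
  cases e with
  | inl b => exact ht.1
  | inr h => exact ht

theorem Icc_subset_interval {e : B ⊕ H} {T : ℝ} (hT : T ∈ G.interval e) :
    Icc 0 T ⊆ G.interval e :=
  (convex_interval e).ordConnected.out (G.zero_mem_interval e) hT

/-- Endpoints are null, so under an integral `deriv` and `derivWithin` are interchangeable. -/
theorem ae_interval_mem_nhds (e : B ⊕ H) :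
    ∀ᵐ t ∂volume.restrict (G.interval e), G.interval e ∈ 𝓝 t := by
  rw [ae_restrict_iff' (measurableSet_interval e)]
  have h0 : ∀ᵐ t : ℝ, t ≠ 0 := by simp [ae_iff]
  cases e with
  | inl b =>
    have h1 : ∀ᵐ t : ℝ, t ≠ G.len b := by simp [ae_iff]
    filter_upwards [h0, h1] with t ht0 ht1 ht
    exact Icc_mem_nhds (lt_of_le_of_ne ht.1 ht0.symm) (lt_of_le_of_ne ht.2 ht1)
  | inr h =>
    filter_upwards [h0] with t ht0 ht
    exact Ici_mem_nhds (lt_of_le_of_ne ht ht0.symm)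

namespace MemH1

variable {e : B ⊕ H} {f g : ℝ → ℝ}

theorem continuousOn (hf : MemH1 (G.interval e) f) : ContinuousOn f (G.interval e) := by
  cases e with
  | inl b =>
    have := (hf.1 _ (G.zero_mem_interval _) _ (G.len_mem_interval b)).continuousOn
    rwa [uIcc_of_le (G.len_pos b).le] at this
  | inr h =>
    intro t ht
    have ht' : (0 : ℝ) ≤ t := ht
    have h1 : t + 1 ∈ G.interval (.inr h : B ⊕ H) := by
      show (0 : ℝ) ≤ t + 1
      linarith
    have h2 := (hf.1 _ (G.zero_mem_interval _) _ h1).continuousOn t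
      (by rw [uIcc_of_le (by linarith)]; exact ⟨ht', by linarith⟩)
    refine h2.mono_of_mem_nhdsWithin ?_
    rw [uIcc_of_le (by linarith)]
    exact mem_nhdsWithin.2 ⟨Iio (t + 1), isOpen_Iio, by simp, fun y hy => ⟨hy.2, hy.1.le⟩⟩

theorem integrable_sq (hf : MemH1 (G.interval e) f) :
    IntegrableOn (fun t => |f t| ^ 2) (G.interval e) := by
  simpa [IntegrableOn] using hf.2.1.integrable_sq

theorem integrable_deriv_sq (hf : MemH1 (G.interval e) f) :
    IntegrableOn (fun t => |deriv f t| ^ 2) (G.interval e) := by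
  simpa [IntegrableOn] using hf.2.2.integrable_sq

theorem integrable_mul (hf : MemH1 (G.interval e) f) (hg : MemH1 (G.interval e) g) :
    IntegrableOn (fun t => f t * g t) (G.interval e) :=
  hf.2.1.integrable_mul hg.2.1

theorem integrable_deriv_mul (hf : MemH1 (G.interval e) f) (hg : MemH1 (G.interval e) g) :
    IntegrableOn (fun t => deriv f t * deriv g t) (G.interval e) :=
  hf.2.2.integrable_mul hg.2.2

end MemH1

/-- The Sobolev inequality on an edge. -/
theorem exists_sq_le_of_memH1 (e : B ⊕ H) : ∃ K, 0 ≤ K ∧ ∀ f, MemH1 (G.interval e) f →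
    ∀ t ∈ G.interval e, f t ^ 2 ≤
      K * ((∫ t in G.interval e, |deriv f t| ^ 2) + ∫ t in G.interval e, |f t| ^ 2) := by
  cases e with
  | inl b =>
    refine ⟨1 + (G.len b - 0)⁻¹, ?_, fun f hf t ht => ?_⟩
    · have := G.len_pos b
      simp only [sub_zero]; positivity
    · exact (hf.1 _ (G.zero_mem_interval _) _ (G.len_mem_interval b)).sq_le_integral
        (G.len_pos b) hf.integrable_deriv_sq ht
  | inr h =>
    -- The constant is `1 + 1/1`, from the unit interval `[t, t + 1]` contained in the half-line.
    refine ⟨2, by norm_num, fun f hf t ht => ?_⟩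
    have ht' : (0 : ℝ) ≤ t := ht
    have hsub : Icc t (t + 1) ⊆ G.interval (.inr h : B ⊕ H) := fun y hy => ht'.trans hy.1
    have h1 := (hf.1 t ht (t + 1) (hsub (by simp))).sq_le_integral (by linarith)
      (hf.integrable_deriv_sq.mono_set hsub) (x := t) (by simp)
    refine h1.trans ?_
    have : (1 : ℝ) + (t + 1 - t)⁻¹ = 2 := by norm_num
    rw [this]
    gcongr
    · exact ae_of_all _ fun _ => by positivity
    · exact hf.integrable_deriv_sq
    · exact ae_of_all _ fun _ => by positivity
    · exact hf.integrable_sq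

theorem memH1_comp (u : G.H1) (e : B ⊕ H) : MemH1 (G.interval e) (G.comp u e) := u.2.2 e

variable [Fintype B] [Fintype H]

theorem h1Norm_nonneg (φ : G.H1) : 0 ≤ h1Norm φ := Real.sqrt_nonneg _

theorem integral_le_h1Norm_sq (φ : G.H1) (e : B ⊕ H) :
    (∫ t in G.interval e, |deriv (G.comp φ e) t| ^ 2) + ∫ t in G.interval e, |G.comp φ e t| ^ 2 ≤
      h1Norm φ ^ 2 := by
  have hnn : ∀ e : B ⊕ H, 0 ≤ (∫ t in G.interval e, |deriv (G.comp φ e) t| ^ 2) +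
      ∫ t in G.interval e, |G.comp φ e t| ^ 2 := fun e =>
    add_nonneg (integral_nonneg fun t => by positivity) (integral_nonneg fun t => by positivity)
  rw [h1Norm, Real.sq_sqrt (Finset.sum_nonneg fun e _ => hnn e)]
  exact Finset.single_le_sum (f := fun e : B ⊕ H =>
    (∫ t in G.interval e, |deriv (G.comp φ e) t| ^ 2) +
      ∫ t in G.interval e, |G.comp φ e t| ^ 2) (fun e _ => hnn e) (Finset.mem_univ e)

variable (G) in
/-- The embedding of `H¹` into the bounded functions. -/
theorem exists_abs_comp_le : ∃ K, 0 ≤ K ∧ ∀ (φ : G.H1) (e : B ⊕ H), ∀ t ∈ G.interval e,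
    |G.comp φ e t| ≤ K * h1Norm φ := by
  choose K hK0 hK using fun e => exists_sq_le_of_memH1 (G := G) e
  refine ⟨√(∑ e, K e), Real.sqrt_nonneg _, fun φ e t ht => ?_⟩
  refine abs_le_of_sq_le_sq ?_ (mul_nonneg (Real.sqrt_nonneg _) (h1Norm_nonneg φ))
  rw [mul_pow, Real.sq_sqrt (Finset.sum_nonneg fun e _ => hK0 e)]
  refine (hK e _ (memH1_comp φ e) t ht).trans ?_
  gcongr
  · exact Finset.sum_nonneg fun e _ => hK0 e
  · exact Finset.single_le_sum (fun e _ => hK0 e) (Finset.mem_univ e)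
  · exact integral_le_h1Norm_sq φ e

end MetricGraph

/-! ### Integrability of powers, integration by parts and the weak equation. -/

namespace MetricGraph

variable {V B H : Type*} {G : MetricGraph V B H}

theorem comp_of_mem (u : G.Point → ℝ) {e : B ⊕ H} {t : ℝ} (ht : t ∈ G.interval e) :
    G.comp u e t = u (G.pt e ⟨t, ht⟩) := by
  simp [comp, ht]

theorem comp_zero_eq (u : G.Point → ℝ) (e : B ⊕ H) :
    G.comp u e 0 = u (Quot.mk _ (.inl (G.origin e))) := by
  rw [comp_of_mem u (G.zero_mem_interval e)]
  exact congrArg u (Quot.sound (Glue.atOrigin e)).symm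

theorem comp_len_eq (u : G.Point → ℝ) (b : B) :
    G.comp u (.inl b) (G.len b) = u (Quot.mk _ (.inl (G.tgt b))) := by
  rw [comp_of_mem u (G.len_mem_interval b)]
  exact congrArg u (Quot.sound (Glue.atEnd b)).symm

/-- A product of powers of bounded functions in `H¹` is integrable as soon as two factors are
square integrable. -/
theorem MemH1.integrable_rpow_mul {e : B ⊕ H} {f g : ℝ → ℝ} {q : ℝ} (hq : 1 ≤ q)
    (hf : MemH1 (G.interval e) f) (hg : MemH1 (G.interval e) g) :
    IntegrableOn (fun t => |f t| ^ q * g t) (G.interval e) := by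
  obtain ⟨K, hK0, hK⟩ := exists_sq_le_of_memH1 (G := G) e
  set M := √(K * ((∫ t in G.interval e, |deriv f t| ^ 2) + ∫ t in G.interval e, |f t| ^ 2))
  have hM : ∀ t ∈ G.interval e, |f t| ≤ M := fun t ht =>
    Real.abs_le_sqrt (hK f hf t ht)
  refine Integrable.mono' ((hf.integrable_mul hg).norm.const_mul (M ^ (q - 1))) ?_ ?_
  · exact (((hf.continuousOn.abs.rpow_const fun t _ => Or.inr (by linarith)).mul
      hg.continuousOn).aestronglyMeasurable (measurableSet_interval e))
  · filter_upwards [ae_restrict_mem (measurableSet_interval e)] with t ht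
    rw [norm_mul, norm_mul, ← mul_assoc, Real.norm_eq_abs (|f t| ^ q),
      abs_of_nonneg (by positivity)]
    gcongr
    rcases eq_or_ne (f t) 0 with h0 | h0
    · simp [h0, Real.zero_rpow (by linarith : q ≠ 0)]
    · calc |f t| ^ q = |f t| ^ (q - 1) * |f t| := by
            rw [← Real.rpow_add_one (abs_ne_zero.2 h0)]; ring_nf
        _ ≤ M ^ (q - 1) * ‖f t‖ := by
            rw [Real.norm_eq_abs]; gcongr
            exact hM t ht

theorem MemH1.integrable_rpow {e : B ⊕ H} {f : ℝ → ℝ} {q : ℝ} (hq : 2 ≤ q)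
    (hf : MemH1 (G.interval e) f) : IntegrableOn (fun t => |f t| ^ q) (G.interval e) := by
  refine ((hf.integrable_rpow_mul (q := q - 1) (by linarith) hf).norm).congr
    (ae_of_all _ fun t => ?_)
  rcases eq_or_ne (f t) 0 with h0 | h0
  · simp [h0, Real.zero_rpow (by linarith : q ≠ 0)]
  · simp only [norm_mul, Real.norm_eq_abs]
    rw [abs_of_nonneg (by positivity : (0 : ℝ) ≤ |f t| ^ (q - 1)),
      ← Real.rpow_add_one (abs_ne_zero.2 h0)]
    ring_nf

namespace IsPositiveSolution

variable [Fintype B] [Fintype H] {p lam ρ : ℝ} {u : G.Point → ℝ}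

theorem comp_pos (hu : IsPositiveSolution p lam ρ u) {e : B ⊕ H} {t : ℝ}
    (ht : t ∈ G.interval e) : 0 < G.comp u e t := by
  rw [comp_of_mem u ht]; exact hu.pos _

theorem hasDerivWithinAt (hu : IsPositiveSolution p lam ρ u) {e : B ⊕ H} {t : ℝ}
    (ht : t ∈ G.interval e) :
    HasDerivWithinAt (G.comp u e) (derivWithin (G.comp u e) (G.interval e) t) (G.interval e) t :=
  (((hu.contDiffOn e).differentiableOn (by norm_num)) t ht).hasDerivWithinAt

theorem contDiffOn_derivWithin (hu : IsPositiveSolution p lam ρ u) (e : B ⊕ H) :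
    ContDiffOn ℝ 1 (derivWithin (G.comp u e) (G.interval e)) (G.interval e) :=
  (hu.contDiffOn e).derivWithin (uniqueDiffOn_interval e) (by norm_num)

theorem hasDerivWithinAt_derivWithin (hu : IsPositiveSolution p lam ρ u) {e : B ⊕ H} {t : ℝ}
    (ht : t ∈ G.interval e) :
    HasDerivWithinAt (derivWithin (G.comp u e) (G.interval e))
      (lam * G.comp u e t - ρ * G.comp u e t ^ (p - 1)) (G.interval e) t := by
  have h := (((hu.contDiffOn_derivWithin e).differentiableOn (by norm_num)) t ht).hasDerivWithinAt
  have h2 := hu.equation e t ht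
  rwa [show derivWithin (derivWithin (G.comp u e) (G.interval e)) (G.interval e) t =
    lam * G.comp u e t - ρ * G.comp u e t ^ (p - 1) by linarith] at h

theorem deriv_eq (hu : IsPositiveSolution p lam ρ u) {e : B ⊕ H} {t : ℝ}
    (ht : G.interval e ∈ 𝓝 t) :
    deriv (G.comp u e) t = derivWithin (G.comp u e) (G.interval e) t :=
  (((hu.hasDerivWithinAt (mem_of_mem_nhds ht))).hasDerivAt ht).deriv

/-- `u'` is `C¹` up to the endpoints and `φ` is absolutely continuous, so the product rule for
absolutely continuous functions applies to `u' φ`. -/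
theorem integral_parts (hu : IsPositiveSolution p lam ρ u) {e : B ⊕ H} {φ : ℝ → ℝ}
    (hφ : MemH1 (G.interval e) φ) {T : ℝ} (hT : T ∈ G.interval e) :
    ∫ t in (0 : ℝ)..T, ((lam * G.comp u e t - ρ * G.comp u e t ^ (p - 1)) * φ t +
        deriv (G.comp u e) t * deriv φ t) =
      derivWithin (G.comp u e) (G.interval e) T * φ T -
        derivWithin (G.comp u e) (G.interval e) 0 * φ 0 := by
  have hT0 := nonneg_of_mem_interval hT
  have hsub := Icc_subset_interval hT
  have hac : AbsolutelyContinuousOnInterval (derivWithin (G.comp u e) (G.interval e)) 0 T :=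
    ContDiffOn.absolutelyContinuousOnInterval
      ((hu.contDiffOn_derivWithin e).mono (by rwa [uIcc_of_le hT0]))
  rw [← hac.integral_deriv_mul_eq_sub (hφ.1 0 (G.zero_mem_interval e) T hT)]
  refine intervalIntegral.integral_congr_ae ?_
  have h := ae_interval_mem_nhds (G := G) e
  rw [ae_restrict_iff' (measurableSet_interval e)] at h
  filter_upwards [h] with t ht htT
  rw [uIoc_of_le hT0] at htT
  have ht' := ht (hsub ⟨htT.1.le, htT.2⟩)
  rw [hu.deriv_eq ht', ((hu.hasDerivWithinAt_derivWithin (mem_of_mem_nhds ht')).hasDerivAt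
    ht').deriv]

end IsPositiveSolution

section Weak

variable [Fintype B] [Fintype H] {p lam ρ : ℝ} {u : G.H1}

theorem IsPositiveSolution.integrable_rpow_mul (hp : 2 ≤ p)
    (hu : IsPositiveSolution p lam ρ (u : G.Point → ℝ)) {e : B ⊕ H} {φ : ℝ → ℝ}
    (hφ : MemH1 (G.interval e) φ) :
    IntegrableOn (fun t => G.comp u e t ^ (p - 1) * φ t) (G.interval e) := by
  refine ((memH1_comp u e).integrable_rpow_mul (q := p - 1) (by linarith) hφ).congr_fun
    (fun t ht => ?_) (measurableSet_interval e)
  simp only [abs_of_pos (hu.comp_pos ht)]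

theorem IsPositiveSolution.integrable_equation_mul (hp : 2 ≤ p)
    (hu : IsPositiveSolution p lam ρ (u : G.Point → ℝ)) {e : B ⊕ H} {φ : ℝ → ℝ}
    (hφ : MemH1 (G.interval e) φ) :
    IntegrableOn (fun t => (lam * G.comp u e t - ρ * G.comp u e t ^ (p - 1)) * φ t +
        deriv (G.comp u e) t * deriv φ t) (G.interval e) := by
  refine Integrable.add ?_ ((memH1_comp u e).integrable_deriv_mul hφ)
  refine ((((memH1_comp u e).integrable_mul hφ).const_mul lam).sub
    ((hu.integrable_rpow_mul hp hφ).const_mul ρ)).congr (ae_of_all _ fun t => ?_)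
  simp only [Pi.sub_apply]; ring

/-- Integration by parts on a bounded edge. -/
theorem IsPositiveSolution.integral_parts_inl
    (hu : IsPositiveSolution p lam ρ (u : G.Point → ℝ)) (φ : G.H1) (b : B) :
    ∫ t in G.interval (.inl b), ((lam * G.comp u (.inl b) t - ρ * G.comp u (.inl b) t ^ (p - 1)) *
        G.comp φ (.inl b) t + deriv (G.comp u (.inl b)) t * deriv (G.comp φ (.inl b)) t) =
      derivWithin (G.comp u (.inl b)) (G.interval (.inl b)) (G.len b) *
          G.comp φ (.inl b) (G.len b) -
        derivWithin (G.comp u (.inl b)) (G.interval (.inl b)) 0 * G.comp φ (.inl b) 0 := by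
  rw [← hu.integral_parts (memH1_comp φ (.inl b)) (G.len_mem_interval b),
    intervalIntegral.integral_of_le (G.len_pos b).le, ← integral_Icc_eq_integral_Ioc]
  rfl

/-- Integration by parts on a half-line. -/
theorem IsPositiveSolution.integral_parts_inr (hp : 2 ≤ p)
    (hu : IsPositiveSolution p lam ρ (u : G.Point → ℝ)) (φ : G.H1) (h : H) :
    ∫ t in G.interval (.inr h), ((lam * G.comp u (.inr h) t - ρ * G.comp u (.inr h) t ^ (p - 1)) *
        G.comp φ (.inr h) t + deriv (G.comp u (.inr h)) t * deriv (G.comp φ (.inr h)) t) =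
      - (derivWithin (G.comp u (.inr h)) (G.interval (.inr h)) 0 * G.comp φ (.inr h) 0) := by
  set F : ℝ → ℝ := fun t => (lam * G.comp u (.inr h) t - ρ * G.comp u (.inr h) t ^ (p - 1)) *
        G.comp φ (.inr h) t + deriv (G.comp u (.inr h)) t * deriv (G.comp φ (.inr h)) t with hF
  set v := derivWithin (G.comp u (.inr h)) (G.interval (.inr h)) with hv
  have hFint : IntegrableOn F (Ioi 0) :=
    (hu.integrable_equation_mul hp (memH1_comp φ (.inr h))).mono_set Ioi_subset_Ici_self
  have hlim := intervalIntegral_tendsto_integral_Ioi 0 hFint tendsto_id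
  have hlim2 : Tendsto (fun T => v T * G.comp φ (.inr h) T) atTop
      (𝓝 ((∫ t in Ioi 0, F t) + v 0 * G.comp φ (.inr h) 0)) := by
    refine (hlim.add_const _).congr' ?_
    filter_upwards [eventually_ge_atTop (0 : ℝ)] with T hT
    have := hu.integral_parts (memH1_comp φ (.inr h)) (T := T) hT
    simp only [id, hF, this]
    ring
  have hint : IntegrableOn (fun T => v T * G.comp φ (.inr h) T) (Ici 0) := by
    refine ((memH1_comp u (.inr h)).2.2.integrable_mul (memH1_comp φ (.inr h)).2.1).congr ?_
    filter_upwards [ae_interval_mem_nhds (G := G) (.inr h)] with t ht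
    simp only [Pi.mul_apply]
    rw [hu.deriv_eq ht]
  -- The boundary term `u' φ` has a limit at infinity and is integrable as a product of two `L²`
  -- functions, so the limit is zero.
  have h0 := IntegrableAtFilter.eq_zero_of_tendsto (μ := volume) (l := atTop)
    ⟨Ici 0, Ici_mem_atTop 0, hint⟩ (fun s hs => ?_) hlim2
  · have : G.interval (.inr h : B ⊕ H) = Ici 0 := rfl
    rw [this, integral_Ici_eq_integral_Ioi]
    linarith
  · obtain ⟨a, ha⟩ := mem_atTop_sets.1 hs
    exact top_le_iff.1 ((by simp : (⊤ : ENNReal) ≤ volume (Ici a)).trans (measure_mono ha))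

/-- The weak formulation of the equation. -/
theorem IsPositiveSolution.weak [Finite V] (hp : 2 ≤ p)
    (hu : IsPositiveSolution p lam ρ (u : G.Point → ℝ)) (φ : G.H1) :
    (∑ e, ∫ t in G.interval e, deriv (G.comp u e) t * deriv (G.comp φ e) t) +
      lam * (∑ e, ∫ t in G.interval e, G.comp u e t * G.comp φ e t) =
      ρ * ∑ e, ∫ t in G.interval e, G.comp u e t ^ (p - 1) * G.comp φ e t := by
  classical
  have := Fintype.ofFinite V
  have hsplit : ∀ e, ∫ t in G.interval e,
      ((lam * G.comp u e t - ρ * G.comp u e t ^ (p - 1)) * G.comp φ e t +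
        deriv (G.comp u e) t * deriv (G.comp φ e) t) =
      (∫ t in G.interval e, deriv (G.comp u e) t * deriv (G.comp φ e) t) +
        lam * (∫ t in G.interval e, G.comp u e t * G.comp φ e t) -
        ρ * ∫ t in G.interval e, G.comp u e t ^ (p - 1) * G.comp φ e t := by
    intro e
    have h1 := (memH1_comp u e).integrable_deriv_mul (memH1_comp φ e)
    have h2 := ((memH1_comp u e).integrable_mul (memH1_comp φ e)).const_mul lam
    have h3 := (hu.integrable_rpow_mul hp (memH1_comp φ e)).const_mul ρ
    rw [← integral_const_mul, ← integral_const_mul, ← integral_add h1 h2]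
    refine Eq.trans (integral_congr_ae (ae_of_all _ fun t => ?_)) (integral_sub (h1.add h2) h3)
    simp only; ring
  have hzero : ∑ e, ∫ t in G.interval e,
      ((lam * G.comp u e t - ρ * G.comp u e t ^ (p - 1)) * G.comp φ e t +
        deriv (G.comp u e) t * deriv (G.comp φ e) t) = 0 := by
    -- Kirchhoff's condition at `v` is multiplied by `φ(v)` and summed over `v`. Exchanging the sums
    -- over vertices and edges leaves, up to sign, exactly the boundary terms of the integrations by
    -- parts.
    have hK := Finset.sum_congr rfl fun (v : V) (_ : v ∈ Finset.univ) =>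
      congrArg (fun x => x * (φ : G.Point → ℝ) (Quot.mk _ (.inl v))) (hu.kirchhoff v)
    simp only [add_mul, zero_mul, Finset.sum_const_zero, Finset.sum_mul, ite_mul] at hK
    rw [Finset.sum_add_distrib, Finset.sum_comm, Finset.sum_comm (s := Finset.univ (α := V))] at hK
    simp only [Finset.sum_ite_eq, Finset.mem_univ, if_true] at hK
    simp only [Fintype.sum_sum_type, hu.integral_parts_inl, hu.integral_parts_inr hp,
      comp_len_eq, comp_zero_eq, Finset.sum_sub_distrib, Finset.sum_neg_distrib] at hK ⊢
    simp only [neg_mul, Finset.sum_neg_distrib] at hK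
    linarith
  simp only [hsplit, Finset.sum_sub_distrib, Finset.sum_add_distrib, ← Finset.mul_sum] at hzero
  linarith

end Weak

end MetricGraph

/-! ### First integral, Nehari identity and the choice of an edge. -/

namespace MetricGraph

variable {V B H : Type*} {G : MetricGraph V B H} {p lam ρ : ℝ}

theorem integrable_firstIntegral (hp : 2 ≤ p) (e : B ⊕ H) (u : G.H1) :
    IntegrableOn (fun t => 1 / 2 * |deriv (G.comp u e) t| ^ 2 - lam / 2 * |G.comp u e t| ^ 2 +
      ρ / p * |G.comp u e t| ^ p) (G.interval e) :=
  (((memH1_comp u e).integrable_deriv_sq.const_mul _).sub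
    ((memH1_comp u e).integrable_sq.const_mul _)).add
    (((memH1_comp u e).integrable_rpow hp).const_mul _)

theorem integral_firstIntegral (hp : 2 ≤ p) (e : B ⊕ H) (u : G.H1) :
    ∫ t in G.interval e, (1 / 2 * |deriv (G.comp u e) t| ^ 2 - lam / 2 * |G.comp u e t| ^ 2 +
      ρ / p * |G.comp u e t| ^ p) =
    1 / 2 * (∫ t in G.interval e, |deriv (G.comp u e) t| ^ 2) -
      lam / 2 * (∫ t in G.interval e, |G.comp u e t| ^ 2) +
      ρ / p * ∫ t in G.interval e, |G.comp u e t| ^ p := by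
  have h1 := (memH1_comp u e).integrable_deriv_sq.const_mul (1 / 2)
  have h2 := (memH1_comp u e).integrable_sq.const_mul (lam / 2)
  have h3 := ((memH1_comp u e).integrable_rpow hp).const_mul (ρ / p)
  rw [← integral_const_mul, ← integral_const_mul, ← integral_const_mul, ← integral_sub h1 h2]
  exact integral_add (h1.sub h2) h3

theorem comp_coe_add_smul (u φ : G.H1) (s : ℝ) (e : B ⊕ H) :
    G.comp ((u + s • φ : G.H1) : G.Point → ℝ) e = G.comp u e + s • G.comp φ e := by
  rw [Submodule.coe_add, Submodule.coe_smul, comp_add, comp_smul]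

theorem ae_deriv_comp_add_smul (u φ : G.H1) (s : ℝ) (e : B ⊕ H) :
    ∀ᵐ t ∂volume.restrict (G.interval e),
      deriv (G.comp ((u + s • φ : G.H1) : G.Point → ℝ) e) t =
        deriv (G.comp u e) t + s * deriv (G.comp φ e) t := by
  filter_upwards [ae_differentiableAt_of_memH1 (memH1_comp u e),
    ae_differentiableAt_of_memH1 (memH1_comp φ e)] with t h1 h2
  rw [comp_coe_add_smul, deriv_add h1 (h2.const_smul s), deriv_const_smul s h2, smul_eq_mul]

theorem integral_deriv_sq_add_smul (u φ : G.H1) (s : ℝ) (e : B ⊕ H) :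
    ∫ t in G.interval e, |deriv (G.comp ((u + s • φ : G.H1) : G.Point → ℝ) e) t| ^ 2 =
      (∫ t in G.interval e, |deriv (G.comp u e) t| ^ 2) +
        s * (2 * ∫ t in G.interval e, deriv (G.comp u e) t * deriv (G.comp φ e) t) +
        s ^ 2 * ∫ t in G.interval e, |deriv (G.comp φ e) t| ^ 2 := by
  have h1 := (memH1_comp u e).integrable_deriv_sq
  have h2 := (((memH1_comp u e).integrable_deriv_mul (memH1_comp φ e)).const_mul 2).const_mul s
  have h3 := (memH1_comp φ e).integrable_deriv_sq.const_mul (s ^ 2)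
  rw [← integral_const_mul 2, ← integral_const_mul s, ← integral_const_mul (s ^ 2),
    ← integral_add h1 h2]
  refine Eq.trans (integral_congr_ae ?_) (integral_add (h1.add h2) h3)
  filter_upwards [ae_deriv_comp_add_smul u φ s e] with t ht
  simp only [ht, sq_abs]
  ring

variable [Fintype B] [Fintype H]

namespace IsPositiveSolution

/-- The quantity `|u'|²/2 - lam u²/2 + ρ u^p/p` is constant on every edge. -/
theorem exists_firstIntegral {u : G.Point → ℝ} (hp : 2 ≤ p) (hu : IsPositiveSolution p lam ρ u)
    (e : B ⊕ H) : ∃ c, ∀ t ∈ G.interval e,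
      1 / 2 * derivWithin (G.comp u e) (G.interval e) t ^ 2 - lam / 2 * G.comp u e t ^ 2 +
        ρ / p * G.comp u e t ^ p = c := by
  set f : ℝ → ℝ := fun t => 1 / 2 * derivWithin (G.comp u e) (G.interval e) t ^ 2 -
    lam / 2 * G.comp u e t ^ 2 + ρ / p * G.comp u e t ^ p
  have hf : ∀ t ∈ G.interval e, HasDerivWithinAt f 0 (G.interval e) t := by
    intro t ht
    have h1 := hu.hasDerivWithinAt ht
    have h2 := hu.hasDerivWithinAt_derivWithin ht
    have h3 := (((h2.pow 2).const_mul (1 / 2)).sub ((h1.pow 2).const_mul (lam / 2))).add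
      ((h1.rpow_const (p := p) (Or.inl (hu.comp_pos ht).ne')).const_mul (ρ / p))
    refine h3.congr_deriv ?_
    have : p ≠ 0 := by linarith
    field_simp
    ring
  refine ⟨f 0, fun t ht => ?_⟩
  have := (convex_interval e).norm_image_sub_le_of_norm_hasDerivWithin_le (C := 0) hf
    (by simp) (G.zero_mem_interval e) ht
  rw [zero_mul, norm_le_zero_iff, sub_eq_zero] at this
  exact this

variable {u : G.H1}

theorem firstIntegral_ae_eq (hu : IsPositiveSolution p lam ρ (u : G.Point → ℝ)) {e : B ⊕ H} {c : ℝ}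
    (hc : ∀ t ∈ G.interval e,
      1 / 2 * derivWithin (G.comp u e) (G.interval e) t ^ 2 - lam / 2 * G.comp u e t ^ 2 +
        ρ / p * G.comp u e t ^ p = c) :
    (fun t => 1 / 2 * |deriv (G.comp u e) t| ^ 2 - lam / 2 * |G.comp u e t| ^ 2 +
      ρ / p * |G.comp u e t| ^ p) =ᵐ[volume.restrict (G.interval e)] fun _ => c := by
  filter_upwards [ae_interval_mem_nhds (G := G) e] with t ht
  have ht' := mem_of_mem_nhds ht
  rw [← hc t ht', sq_abs, sq_abs, hu.deriv_eq ht, abs_of_pos (hu.comp_pos ht')]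

theorem integral_firstIntegral_inl (hu : IsPositiveSolution p lam ρ (u : G.Point → ℝ)) {b : B}
    {c : ℝ} (hc : ∀ t ∈ G.interval (.inl b),
      1 / 2 * derivWithin (G.comp u (.inl b)) (G.interval (.inl b)) t ^ 2 -
        lam / 2 * G.comp u (.inl b) t ^ 2 + ρ / p * G.comp u (.inl b) t ^ p = c) :
    ∫ t in G.interval (.inl b), (1 / 2 * |deriv (G.comp u (.inl b)) t| ^ 2 -
      lam / 2 * |G.comp u (.inl b) t| ^ 2 + ρ / p * |G.comp u (.inl b) t| ^ p) = c * G.len b := by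
  rw [integral_congr_ae (hu.firstIntegral_ae_eq hc)]
  have h : G.interval (.inl b : B ⊕ H) = Icc 0 (G.len b) := rfl
  rw [h, setIntegral_const, Real.volume_real_Icc_of_le (G.len_pos b).le]
  simp [mul_comm]

/-- Each term of the first integral is integrable, and a constant integrable on a half-line is zero.
-/
theorem integral_firstIntegral_inr (hp : 2 ≤ p)
    (hu : IsPositiveSolution p lam ρ (u : G.Point → ℝ)) (h : H) :
    ∫ t in G.interval (.inr h), (1 / 2 * |deriv (G.comp u (.inr h)) t| ^ 2 -
      lam / 2 * |G.comp u (.inr h) t| ^ 2 + ρ / p * |G.comp u (.inr h) t| ^ p) = 0 := by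
  obtain ⟨c, hc⟩ := hu.exists_firstIntegral hp (.inr h)
  have h1 := (integrable_firstIntegral (lam := lam) (ρ := ρ) hp (.inr h) u).congr
    (hu.firstIntegral_ae_eq hc)
  have h2 : G.interval (.inr h : B ⊕ H) = Ici 0 := rfl
  have h3 : c = 0 := by
    rw [h2, ← IntegrableOn, integrableOn_const_iff] at h1
    simpa using h1
  rw [integral_congr_ae (hu.firstIntegral_ae_eq hc), h3, integral_zero]

/-- The weak equation tested with `φ = u`. -/
theorem nehari [Finite V] (hp : 2 ≤ p) (hu : IsPositiveSolution p lam ρ (u : G.Point → ℝ)) :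
    (∑ e, ∫ t in G.interval e, |deriv (G.comp u e) t| ^ 2) + lam * mass u =
      ρ * ∑ e, ∫ t in G.interval e, |G.comp u e t| ^ p := by
  have h := hu.weak hp u
  have h1 : ∀ e, ∫ t in G.interval e, G.comp u e t ^ (p - 1) * G.comp u e t =
      ∫ t in G.interval e, |G.comp u e t| ^ p := fun e =>
    setIntegral_congr_fun (measurableSet_interval e) fun t ht => by
      have := hu.comp_pos ht
      simp only [abs_of_pos this, ← Real.rpow_add_one this.ne', sub_add_cancel]
  simp only [h1, ← pow_two] at h
  simpa only [mass, sq_abs] using h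

/-- A bounded edge on which the first integral is very negative, if `lam` is large. -/
theorem exists_firstIntegral_le [Finite V] (hp : 6 < p) {μ C : ℝ}
    (hu : IsPositiveSolution p lam ρ (u : G.Point → ℝ)) (hmass : mass u = μ)
    (henergy : |energy p ρ u| ≤ C)
    (hlam : C * (p + 2) / (p - 2) ≤ lam * (μ * (p - 6) / (4 * (p - 2))))
    (hneg : 0 < lam * (μ * (p - 6) / (4 * (p - 2)))) :
    ∃ b : B, ∃ c, (∀ t ∈ G.interval (.inl b),
      1 / 2 * derivWithin (G.comp u (.inl b)) (G.interval (.inl b)) t ^ 2 -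
        lam / 2 * G.comp u (.inl b) t ^ 2 + ρ / p * G.comp u (.inl b) t ^ p = c) ∧
      c * G.len b * Fintype.card B ≤ -(lam * (μ * (p - 6) / (4 * (p - 2)))) := by
  have hp2 : 2 ≤ p := by linarith
  set κ := lam * (μ * (p - 6) / (4 * (p - 2))) with hκ
  choose c hc using fun b : B => hu.exists_firstIntegral hp2 (.inl b)
  have hsum : ∑ b, c b * G.len b ≤ -κ := by
    have h1 := hu.nehari hp2
    have h2 : ∑ e, ∫ t in G.interval e, (1 / 2 * |deriv (G.comp u e) t| ^ 2 -
        lam / 2 * |G.comp u e t| ^ 2 + ρ / p * |G.comp u e t| ^ p) = ∑ b, c b * G.len b := by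
      simp only [Fintype.sum_sum_type, hu.integral_firstIntegral_inr hp2,
        fun b => hu.integral_firstIntegral_inl (hc b), Finset.sum_const_zero, add_zero]
    simp only [integral_firstIntegral hp2, Finset.sum_add_distrib, Finset.sum_sub_distrib,
      ← Finset.mul_sum] at h2
    rw [← h2]
    change _ - lam / 2 * mass u + _ ≤ _
    have h3 := (abs_le.1 henergy).2
    rw [energy] at h3
    rw [hmass] at h1 ⊢
    rw [show energy p ρ u = (1 / 2) * (∑ e, ∫ t in G.interval e, |deriv (G.comp u e) t| ^ 2) -
      (ρ / p) * ∑ e, ∫ t in G.interval e, |G.comp u e t| ^ p from rfl] at henergy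
    generalize (∑ e, ∫ t in G.interval e, |deriv (G.comp u e) t| ^ 2) = A at *
    generalize (∑ e, ∫ t in G.interval e, |G.comp u e t| ^ p) = P at *
    have hpne : p ≠ 0 := by linarith
    have hp2' : 0 < p - 2 := by linarith
    have h4 : ρ / p * P = (A + lam * μ) / p := by rw [h1]; ring
    rw [h4] at h3 ⊢
    set E := 1 / 2 * A - (A + lam * μ) / p with hE
    -- The exponent 6 appears here: eliminating `A` leaves `lam * μ` with coefficient `(2(p+2) -
    -- (p-2)²) / (2p(p-2)) = -(p-6) / (2(p-2))`. Of the resulting `-2κ`, one `κ` absorbs the energy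
    -- term by `hlam`.
    have h5 : 1 / 2 * A - lam / 2 * μ + (A + lam * μ) / p = E * (p + 2) / (p - 2) - 2 * κ := by
      rw [hκ, hE]; field_simp; ring
    rw [h5]
    have h6 : E * (p + 2) / (p - 2) ≤ C * (p + 2) / (p - 2) := by gcongr
    linarith
  have hne : (Finset.univ : Finset B).Nonempty := by
    by_contra h
    rw [Finset.not_nonempty_iff_eq_empty] at h
    rw [h, Finset.sum_empty] at hsum
    linarith
  -- Pigeonhole: some edge lies below the average share `-κ / card B`.
  obtain ⟨b, -, hb⟩ := Finset.exists_le_of_sum_le hne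
    (f := fun b => c b * G.len b) (g := fun _ => -κ / Fintype.card B) (by
      have : (Fintype.card B : ℝ) ≠ 0 := by
        have := Finset.card_pos.2 hne
        simpa using this.ne'
      simp only [Finset.sum_const, Finset.card_univ, nsmul_eq_mul]
      rwa [mul_div_cancel₀ _ this])
  have hcard : (0 : ℝ) < Fintype.card B := by
    have := Finset.card_pos.2 hne
    exact_mod_cast this
  exact ⟨b, c b, hc b, by rwa [le_div_iff₀ hcard] at hb⟩

end IsPositiveSolution

/-! ### Directional derivatives of the energy. -/

/-- Differentiation under the integral. For `|s| < 1` the sup bound `M` on `|u| + |φ|` absorbs the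
power `p - 2`, and the remaining `(|u| + |φ|) |φ|` is integrable as a product of `L²` functions. -/
theorem hasDerivAt_integral_rpow (hp : 2 ≤ p) (u φ : G.H1) (e : B ⊕ H) :
    HasDerivAt (fun s : ℝ =>
        ∫ t in G.interval e, |G.comp ((u + s • φ : G.H1) : G.Point → ℝ) e t| ^ p)
      (∫ t in G.interval e, p * |G.comp u e t| ^ (p - 2) * G.comp u e t * G.comp φ e t) 0 := by
  obtain ⟨K, hK0, hK⟩ := exists_abs_comp_le G
  set M := K * h1Norm u + K * h1Norm φ
  have hw : ∀ s ∈ Metric.ball (0 : ℝ) 1, ∀ t,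
      |G.comp u e t + s * G.comp φ e t| ≤ |G.comp u e t| + |G.comp φ e t| := by
    intro s hs t
    rw [mem_ball_zero_iff, Real.norm_eq_abs] at hs
    refine (abs_add_le _ _).trans ?_
    rw [abs_mul]
    gcongr
    exact mul_le_of_le_one_left (abs_nonneg _) hs.le
  have hu := memH1_comp u e
  have hφ := memH1_comp φ e
  have main := (hasDerivAt_integral_of_dominated_loc_of_deriv_le (𝕜 := ℝ)
    (μ := volume.restrict (G.interval e)) (s := Metric.ball (0 : ℝ) 1) (x₀ := (0 : ℝ))
    (F := fun s t => |G.comp u e t + s * G.comp φ e t| ^ p)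
    (F' := fun s t => p * |G.comp u e t + s * G.comp φ e t| ^ (p - 2) *
      (G.comp u e t + s * G.comp φ e t) * G.comp φ e t)
    (bound := fun t => p * M ^ (p - 2) * ((|G.comp u e t| + |G.comp φ e t|) * |G.comp φ e t|))
    (Metric.ball_mem_nhds _ one_pos) ?_ ?_ ?_ ?_ ?_ ?_).2
  · simp only [comp_coe_add_smul, Pi.add_apply, Pi.smul_apply, smul_eq_mul]
    simpa using main
  · refine Eventually.of_forall fun s => ?_
    exact ((hu.continuousOn.add (hφ.continuousOn.const_smul s)).abs.rpow_const
      fun t _ => Or.inr (by linarith)).aestronglyMeasurable (measurableSet_interval e)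
  · simpa [IntegrableOn] using hu.integrable_rpow hp
  · have h1 : ContinuousOn (fun t => G.comp u e t + 0 * G.comp φ e t) (G.interval e) :=
      hu.continuousOn.add (continuousOn_const.mul hφ.continuousOn)
    exact (((continuousOn_const.mul (h1.abs.rpow_const
      fun t _ => Or.inr (by linarith))).mul h1).mul hφ.continuousOn).aestronglyMeasurable
      (measurableSet_interval e)
  · filter_upwards [ae_restrict_mem (measurableSet_interval e)] with t ht s hs
    have h1 := hw s hs t
    have h2 : |G.comp u e t| + |G.comp φ e t| ≤ M := add_le_add (hK u e t ht) (hK φ e t ht)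
    simp only [norm_mul, Real.norm_eq_abs, ← mul_assoc]
    rw [abs_of_nonneg (by linarith : 0 ≤ p), abs_of_nonneg
      (by positivity : (0 : ℝ) ≤ |G.comp u e t + s * G.comp φ e t| ^ (p - 2))]
    have hM : 0 ≤ M := (by positivity : 0 ≤ |G.comp u e t| + |G.comp φ e t|).trans h2
    have hp0 : 0 ≤ p := by linarith
    gcongr
    exact h1.trans h2
  · refine Integrable.const_mul ?_ _
    refine ((hu.integrable_mul hφ).norm.add (hφ.integrable_mul hφ).norm).congr
      (ae_of_all _ fun t => ?_)
    simp only [Pi.add_apply, norm_mul, Real.norm_eq_abs]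
    ring
  · refine ae_of_all _ fun t s _ => ?_
    have h1 : HasDerivAt (fun s => G.comp u e t + s * G.comp φ e t) (G.comp φ e t) s := by
      simpa using ((hasDerivAt_id s).mul_const (G.comp φ e t)).const_add (G.comp u e t)
    exact (hasDerivAt_abs_rpow (G.comp u e t + s * G.comp φ e t) (by linarith : 1 < p)).comp s h1

/-- The directional derivatives of the energy. -/
theorem hasLineDerivAt_energy (hp : 2 ≤ p) (u φ : G.H1) :
    HasLineDerivAt ℝ (energy (G := G) p ρ)
      ((∑ e, ∫ t in G.interval e, deriv (G.comp u e) t * deriv (G.comp φ e) t) -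
        ρ * ∑ e, ∫ t in G.interval e, |G.comp u e t| ^ (p - 2) * G.comp u e t * G.comp φ e t)
      u φ := by
  have h1 : HasDerivAt (fun s : ℝ => ∑ e, ∫ t in G.interval e,
      |deriv (G.comp ((u + s • φ : G.H1) : G.Point → ℝ) e) t| ^ 2)
      (∑ e, 2 * ∫ t in G.interval e, deriv (G.comp u e) t * deriv (G.comp φ e) t) 0 := by
    refine HasDerivAt.fun_sum fun e _ => ?_
    simp only [integral_deriv_sq_add_smul]
    have := (((hasDerivAt_id (0 : ℝ)).mul_const
      (2 * ∫ t in G.interval e, deriv (G.comp u e) t * deriv (G.comp φ e) t)).const_add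
      (∫ t in G.interval e, |deriv (G.comp u e) t| ^ 2)).fun_add
      (((hasDerivAt_id (0 : ℝ)).pow 2).mul_const (∫ t in G.interval e, |deriv (G.comp φ e) t| ^ 2))
    simpa using this
  have h2 := HasDerivAt.fun_sum (u := Finset.univ) fun (e : B ⊕ H) _ =>
    hasDerivAt_integral_rpow hp u φ e
  have h3 := (h1.const_mul (1 / 2)).sub (h2.const_mul (ρ / p))
  refine h3.congr_deriv ?_
  have hp0 : p ≠ 0 := by linarith
  simp only [mul_assoc p, integral_const_mul, ← Finset.mul_sum]
  field_simp

end MetricGraph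

/-! ### Test functions localized on a bounded edge. -/

theorem memLp_two_Icc_of_continuousOn {f : ℝ → ℝ} {a b : ℝ} (hf : ContinuousOn f (Icc a b)) :
    MemLp f 2 (volume.restrict (Icc a b)) :=
  (memLp_two_iff_integrable_sq (hf.aestronglyMeasurable measurableSet_Icc)).2
    ((hf.pow 2).integrableOn_compact isCompact_Icc)

namespace MetricGraph

variable {V B H : Type*} {G : MetricGraph V B H}

open Classical in
/-- The function equal to `ψ` on the bounded edge `b` and to zero elsewhere. -/
noncomputable def edgeFun (b : B) (ψ : ℝ → ℝ) (h0 : ψ 0 = 0) (h1 : ψ (G.len b) = 0) :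
    G.Point → ℝ :=
  Quot.lift (Sum.elim (fun _ => 0)
    (fun x : Σ e : B ⊕ H, G.interval e => if x.1 = .inl b then ψ x.2 else 0)) (by
    rintro _ _ (e | b')
    · simp [h0]
    · by_cases h : b' = b
      · subst h; simp [h1]
      · simp [h])

theorem isQuotientMap_mk : letI : TopologicalSpace V := ⊥
    IsQuotientMap (Quot.mk G.Glue : V ⊕ (Σ e : B ⊕ H, G.interval e) → G.Point) :=
  letI : TopologicalSpace V := ⊥
  isQuotientMap_quot_mk

theorem continuous_pt (e : B ⊕ H) : Continuous (G.pt e) :=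
  letI : TopologicalSpace V := ⊥
  isQuotientMap_mk.continuous.comp (continuous_inr.comp continuous_sigmaMk)

theorem continuous_edgeFun (b : B) {ψ : ℝ → ℝ} (hψ : Continuous ψ) (h0 : ψ 0 = 0)
    (h1 : ψ (G.len b) = 0) : Continuous (edgeFun (G := G) b ψ h0 h1) := by
  let : TopologicalSpace V := ⊥
  have : DiscreteTopology V := ⟨rfl⟩
  refine (isQuotientMap_mk (G := G)).continuous_iff.2 ?_
  refine continuous_sum_dom.2 ⟨continuous_of_discreteTopology, continuous_sigma fun e => ?_⟩
  by_cases he : e = .inl b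
  · subst he
    refine (hψ.comp continuous_subtype_val).congr fun t => ?_
    simp [edgeFun]
  · refine continuous_zero.congr fun t => ?_
    simp [edgeFun, he]

theorem comp_edgeFun (b : B) {ψ : ℝ → ℝ} (h0 : ψ 0 = 0) (h1 : ψ (G.len b) = 0) {t : ℝ}
    (ht : t ∈ G.interval (.inl b)) : G.comp (edgeFun (G := G) b ψ h0 h1) (.inl b) t = ψ t := by
  rw [comp_of_mem _ ht]
  simp [edgeFun, pt]

theorem comp_edgeFun_of_ne (b : B) {ψ : ℝ → ℝ} (h0 : ψ 0 = 0) (h1 : ψ (G.len b) = 0)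
    {e : B ⊕ H} (he : e ≠ .inl b) : G.comp (edgeFun (G := G) b ψ h0 h1) e = 0 := by
  funext t
  by_cases ht : t ∈ G.interval e
  · rw [comp_of_mem _ ht]
    simp [edgeFun, pt, he]
  · simp [comp, ht]

theorem comp_mul (u v : G.Point → ℝ) (e : B ⊕ H) : G.comp (u * v) e = G.comp u e * G.comp v e := by
  funext t
  by_cases h : t ∈ G.interval e <;> simp [comp, h]

/-- Since `tsupport ψ` avoids the endpoints, the predicate of lying over it descends to the
quotient. The set it defines is closed, contains the support, and lies in the compact image of
`tsupport ψ` under `pt`. -/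
theorem hasCompactSupport_edgeFun (b : B) {ψ : ℝ → ℝ} (h0 : ψ 0 = 0) (h1 : ψ (G.len b) = 0)
    (hψ : tsupport ψ ⊆ Ioo 0 (G.len b)) : HasCompactSupport (edgeFun (G := G) b ψ h0 h1) := by
  let : TopologicalSpace V := ⊥
  have : DiscreteTopology V := ⟨rfl⟩
  let P : G.Point → Prop := Quot.lift (Sum.elim (fun _ => False)
    (fun x : Σ e : B ⊕ H, G.interval e => x.1 = .inl b ∧ (x.2 : ℝ) ∈ tsupport ψ)) (by
    have hn0 : (0 : ℝ) ∉ tsupport ψ := fun h => lt_irrefl _ (hψ h).1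
    have hn1 : G.len b ∉ tsupport ψ := fun h => lt_irrefl _ (hψ h).2
    rintro _ _ (e | b')
    · simp [hn0]
    · by_cases h : b' = b
      · subst h; simp [hn1]
      · simp [h])
  have hclosed : IsClosed {x | P x} := by
    refine (isQuotientMap_mk (G := G)).isClosed_preimage.1 (isClosed_sum_iff.2 ?_)
    refine ⟨isClosed_discrete _, isClosed_sigma_iff.2 fun e => ?_⟩
    by_cases he : e = .inl b
    · subst he
      convert (isClosed_tsupport ψ).preimage
        (continuous_subtype_val (p := fun t => t ∈ G.interval (.inl b : B ⊕ H)))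
      ext t
      exact and_iff_right (rfl : (Sum.inl b : B ⊕ H) = .inl b)
    · convert isClosed_empty
      ext t
      exact ⟨fun h => he (And.left (a := e = .inl b) h), fun h => h.elim⟩
  have hcomp : IsCompact (G.pt (.inl b) '' (Subtype.val ⁻¹' tsupport ψ)) := by
    refine IsCompact.image ?_ (continuous_pt _)
    have hcl : IsClosed (G.interval (.inl b : B ⊕ H)) := isClosed_Icc
    refine hcl.isClosedEmbedding_subtypeVal.isCompact_preimage ?_
    exact isCompact_Icc.of_isClosed_subset (isClosed_tsupport ψ)
      (hψ.trans Ioo_subset_Icc_self)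
  refine hcomp.of_isClosed_subset (isClosed_tsupport _) ((closure_minimal ?_ hclosed).trans ?_)
  · intro x
    induction x using Quot.ind with
    | mk x =>
      rcases x with v | ⟨e, t⟩
      · intro h; exact (h rfl).elim
      · intro h
        replace h : (open Classical in if e = .inl b then ψ t else 0) ≠ 0 := h
        by_cases he : e = .inl b
        · subst he
          refine ⟨rfl, subset_tsupport ψ ?_⟩
          simpa using h
        · simp [he] at h
  · intro x
    induction x using Quot.ind with
    | mk x =>
      rcases x with v | ⟨e, t⟩
      · intro h; exact h.elim
      · rintro ⟨h1, h2⟩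
        simp only at h1 h2
        subst h1
        exact ⟨t, h2, rfl⟩

/-- Localization of a function in `H¹` to a bounded edge. -/
theorem exists_localized (u : G.H1) (b : B) {ψ : ℝ → ℝ} (hψ : ContDiff ℝ 1 ψ)
    (hsupp : tsupport ψ ⊆ Ioo 0 (G.len b))
    (hu : ContDiffOn ℝ 1 (G.comp u (.inl b)) (G.interval (.inl b))) :
    ∃ φ : G.H1, HasCompactSupport (φ : G.Point → ℝ) ∧
      G.comp φ (.inl b) = (fun t => G.comp u (.inl b) t * ψ t) ∧
      ∀ e, e ≠ .inl b → G.comp φ e = 0 := by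
  have hz : ∀ t, t ∉ Ioo 0 (G.len b) → ψ t = 0 := fun t ht =>
    image_eq_zero_of_notMem_tsupport fun h => ht (hsupp h)
  have h0 : ψ 0 = 0 := hz 0 (by simp)
  have h1 : ψ (G.len b) = 0 := hz _ (by simp)
  have hc : G.comp ((u : G.Point → ℝ) * edgeFun b ψ h0 h1) (.inl b) =
      fun t => G.comp u (.inl b) t * ψ t := by
    funext t
    rw [comp_mul, Pi.mul_apply]
    by_cases ht : t ∈ G.interval (.inl b)
    · rw [comp_edgeFun b h0 h1 ht]
    · rw [hz t fun h => ht (Ioo_subset_Icc_self h)]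
      simp [comp, ht]
  have hne : ∀ e, e ≠ .inl b → G.comp ((u : G.Point → ℝ) * edgeFun b ψ h0 h1) e = 0 := by
    intro e he
    rw [comp_mul, comp_edgeFun_of_ne b h0 h1 he, mul_zero]
  refine ⟨⟨(u : G.Point → ℝ) * edgeFun b ψ h0 h1, ?_, fun e => ?_⟩, ?_, hc, hne⟩
  · exact u.2.1.mul (continuous_edgeFun b hψ.continuous h0 h1)
  · by_cases he : e = .inl b
    · subst he
      rw [hc]
      have hcd : ContDiffOn ℝ 1 (fun t => G.comp u (.inl b) t * ψ t) (G.interval (.inl b)) :=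
        hu.mul hψ.contDiffOn
      have hint : G.interval (.inl b : B ⊕ H) = Icc 0 (G.len b) := rfl
      refine ⟨fun x hx y hy => ?_, ?_, ?_⟩
      · exact ContDiffOn.absolutelyContinuousOnInterval
          (hcd.mono ((convex_interval _).ordConnected.uIcc_subset hx hy))
      · exact memLp_two_Icc_of_continuousOn hcd.continuousOn
      · refine MemLp.ae_eq (f := derivWithin (fun t => G.comp u (.inl b) t * ψ t)
          (G.interval (.inl b))) ?_ ?_
        · filter_upwards [ae_interval_mem_nhds (G := G) (.inl b)] with t ht
          exact derivWithin_of_mem_nhds ht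
        · exact memLp_two_Icc_of_continuousOn (hcd.continuousOn_derivWithin
            (uniqueDiffOn_interval (.inl b)) le_rfl)
    · rw [hne e he, ← comp_zero (G := G) e]
      exact (0 : G.H1).2.2 e
  · exact (hasCompactSupport_edgeFun b h0 h1 hsupp).mul_left

end MetricGraph

/-! ### The second variation in the direction `u ψ`. -/

namespace MetricGraph

variable {V B H : Type*} {G : MetricGraph V B H}

theorem integral_interval_inl_eq_sub (b : B) {F F' : ℝ → ℝ}
    (hF : ∀ t ∈ G.interval (.inl b), HasDerivWithinAt F (F' t) (G.interval (.inl b)) t)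
    (hF' : ContinuousOn F' (G.interval (.inl b))) :
    ∫ t in G.interval (.inl b), F' t = F (G.len b) - F 0 := by
  have h : G.interval (.inl b : B ⊕ H) = Icc 0 (G.len b) := rfl
  rw [h] at hF hF' ⊢
  rw [integral_Icc_eq_integral_Ioc, ← intervalIntegral.integral_of_le (G.len_pos b).le]
  refine intervalIntegral.integral_eq_sub_of_hasDerivAt_of_le (G.len_pos b).le
    (fun t ht => (hF t ht).continuousWithinAt)
    (fun t ht => (hF t (Ioo_subset_Icc_self ht)).hasDerivAt (Icc_mem_nhds ht.1 ht.2)) ?_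
  exact ContinuousOn.intervalIntegrable_of_Icc (G.len_pos b).le hF'

variable [Fintype B] [Fintype H] {p lam ρ : ℝ} {u : G.H1}

theorem IsPositiveSolution.continuousOn_rpow (hu : IsPositiveSolution p lam ρ (u : G.Point → ℝ))
    (e : B ⊕ H) (q : ℝ) : ContinuousOn (fun t => G.comp u e t ^ q) (G.interval e) :=
  (hu.contDiffOn e).continuousOn.rpow_const fun _ ht => Or.inl (hu.comp_pos ht).ne'

/-- The second variation at a solution `u` in the direction of `u ψ`. -/
theorem IsPositiveSolution.secondVariation_eq (hu : IsPositiveSolution p lam ρ (u : G.Point → ℝ))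
    {b : B} {ψ : ℝ → ℝ} (hψ : ContDiff ℝ 1 ψ) (h0 : ψ 0 = 0) (h1 : ψ (G.len b) = 0) {φ : G.H1}
    (hφ : G.comp φ (.inl b) = fun t => G.comp u (.inl b) t * ψ t)
    (hne : ∀ e, e ≠ .inl b → G.comp φ e = 0) :
    secondVariation p lam ρ u φ = ∫ t in G.interval (.inl b),
      (G.comp u (.inl b) t ^ 2 * deriv ψ t ^ 2 -
        (p - 2) * ρ * (G.comp u (.inl b) t ^ p * ψ t ^ 2)) := by
  set U := G.comp u (.inl b) with hU
  set v := derivWithin U (G.interval (.inl b)) with hv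
  have hcU : ContinuousOn U (G.interval (.inl b)) := (hu.contDiffOn (.inl b)).continuousOn
  have hcv : ContinuousOn v (G.interval (.inl b)) := (hu.contDiffOn_derivWithin _).continuousOn
  have hcψ := hψ.continuous.continuousOn (s := G.interval (.inl b))
  have hcψ' := (hψ.continuous_deriv le_rfl).continuousOn (s := G.interval (.inl b))
  have hcq := fun q => hu.continuousOn_rpow (.inl b) q
  have hcomp : IsCompact (G.interval (.inl b : B ⊕ H)) := isCompact_Icc
  -- The derivative of `u u' ψ²`, with `u''` replaced through the equation. It integrates to zero,
  -- and the integrand of the second variation exceeds the target integrand by precisely `F'`.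
  let F' : ℝ → ℝ := fun t => (v t * v t + U t * (lam * U t - ρ * U t ^ (p - 1))) * ψ t ^ 2 +
    U t * v t * (2 * ψ t * deriv ψ t)
  have hF' : ContinuousOn F' (G.interval (.inl b)) :=
    (((hcv.mul hcv).add (hcU.mul ((continuousOn_const.mul hcU).sub
      (continuousOn_const.mul (hcq (p - 1)))))).mul (hcψ.pow 2)).add
      ((hcU.mul hcv).mul ((continuousOn_const.mul hcψ).mul hcψ'))
  have hzero : ∫ t in G.interval (.inl b), F' t = 0 := by
    rw [integral_interval_inl_eq_sub b (F := fun t => U t * v t * ψ t ^ 2) (F' := F') ?_ hF']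
    · simp [h0, h1]
    · intro t ht
      have d1 := hu.hasDerivWithinAt ht
      have d2 := hu.hasDerivWithinAt_derivWithin ht
      have d3 := ((hψ.differentiable one_ne_zero) t).hasDerivAt.hasDerivWithinAt
        (s := G.interval (.inl b))
      refine ((d1.fun_mul d2).fun_mul (d3.fun_pow 2)).congr_deriv ?_
      simp only [F']
      push_cast
      ring
  have hT : ContinuousOn (fun t => U t ^ 2 * deriv ψ t ^ 2 -
      (p - 2) * ρ * (U t ^ p * ψ t ^ 2)) (G.interval (.inl b)) :=
    ((hcU.pow 2).mul (hcψ'.pow 2)).sub (continuousOn_const.mul ((hcq p).mul (hcψ.pow 2)))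
  rw [secondVariation, Finset.sum_eq_single (.inl b) ?_ (by simp)]
  · rw [← add_zero (∫ t in G.interval (.inl b), (U t ^ 2 * deriv ψ t ^ 2 -
      (p - 2) * ρ * (U t ^ p * ψ t ^ 2))), ← hzero,
      ← integral_add (hT.integrableOn_compact hcomp) (hF'.integrableOn_compact hcomp)]
    refine integral_congr_ae ?_
    filter_upwards [ae_interval_mem_nhds (G := G) (.inl b)] with t ht
    have ht' := mem_of_mem_nhds ht
    have hpos := hu.comp_pos ht'
    have d1 := (hu.hasDerivWithinAt ht').hasDerivAt ht
    have d3 := ((hψ.differentiable one_ne_zero) t).hasDerivAt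
    have hd : deriv (fun t => U t * ψ t) t = v t * ψ t + U t * deriv ψ t := (d1.fun_mul d3).deriv
    simp only [hφ, hd, sq_abs, F', ← hU]
    rw [← hU] at hpos
    rw [abs_of_pos hpos]
    have e1 : U t ^ p = U t ^ (p - 2) * U t ^ 2 := by
      rw [← Real.rpow_natCast, ← Real.rpow_add hpos]; norm_num
    have e2 : U t ^ (p - 1) = U t ^ (p - 2) * U t := by
      rw [← Real.rpow_add_one hpos.ne']; ring_nf
    rw [e1, e2]
    ring
  · intro e _ he
    rw [hne e he]
    have : deriv (0 : ℝ → ℝ) = 0 := by funext t; exact deriv_const t 0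
    simp [this]

theorem integral_sq_le_mass (u : G.H1) (e : B ⊕ H) :
    ∫ t in G.interval e, |G.comp u e t| ^ 2 ≤ mass u :=
  Finset.single_le_sum (f := fun e => ∫ t in G.interval e, |G.comp u e t| ^ 2)
    (fun e _ => integral_nonneg fun t => by positivity) (Finset.mem_univ e)

/-- An upper bound for the second variation at a solution bounded from below on an edge. -/
theorem IsPositiveSolution.integral_secondVariation_le (hp : 2 ≤ p) (hρ : 0 ≤ ρ) (hlam : 0 ≤ lam)
    (hu : IsPositiveSolution p lam ρ (u : G.Point → ℝ)) {b : B} {δ M : ℝ} (hδ : 0 < δ)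
    (hlow : ∀ t ∈ G.interval (.inl b), δ ≤ G.comp u (.inl b) t)
    {ψ : ℝ → ℝ} (hψ : ContDiff ℝ 2 ψ) (hsupp : tsupport ψ ⊆ Ioo 0 (G.len b))
    (hM1 : ∀ t, deriv ψ t ^ 2 ≤ M) (hM2 : ∀ t, |deriv (deriv fun s => ψ s ^ 2) t| ≤ M) :
    ∫ t in G.interval (.inl b), (G.comp u (.inl b) t ^ 2 * deriv ψ t ^ 2 -
        (p - 2) * ρ * (G.comp u (.inl b) t ^ p * ψ t ^ 2)) ≤
      M * mass u - (p - 2) *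
        (lam * (δ ^ 2 * ∫ t in G.interval (.inl b), ψ t ^ 2) - M * mass u) := by
  set U := G.comp u (.inl b) with hU
  set v := derivWithin U (G.interval (.inl b)) with hv
  set η : ℝ → ℝ := fun s => ψ s ^ 2 with hη
  have hη2 : ContDiff ℝ 2 η := hψ.pow 2
  have hη1 : ContDiff ℝ 1 (deriv η) := by
    have : ContDiff ℝ (1 + 1) η := by norm_num; exact hη2
    exact (contDiff_succ_iff_deriv.1 this).2.2
  have hcU : ContinuousOn U (G.interval (.inl b)) := (hu.contDiffOn (.inl b)).continuousOn
  have hcη := hη2.continuous.continuousOn (s := G.interval (.inl b))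
  have hcη2 := (hη1.continuous_deriv le_rfl).continuousOn (s := G.interval (.inl b))
  have hcψ' := (hψ.continuous_deriv one_le_two).continuousOn (s := G.interval (.inl b))
  have hcq := fun q => hu.continuousOn_rpow (.inl b) q
  have hcomp : IsCompact (G.interval (.inl b : B ⊕ H)) := isCompact_Icc
  have hms := measurableSet_interval (G := G) (.inl b)
  have hM0 : 0 ≤ M := (sq_nonneg _).trans (hM1 0)
  have hz : ∀ t, t ∉ Ioo 0 (G.len b) → ψ t = 0 := fun t ht =>
    image_eq_zero_of_notMem_tsupport fun h => ht (hsupp h)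
  have hη' : ∀ t, deriv η t = 2 * ψ t * deriv ψ t := fun t => by
    have := (((hψ.differentiable two_ne_zero) t).hasDerivAt.fun_pow 2).deriv
    simpa using this
  have iU2 : IntegrableOn (fun t => U t ^ 2) (G.interval (.inl b)) :=
    (hcU.pow 2).integrableOn_compact hcomp
  have iUη : IntegrableOn (fun t => U t * η t) (G.interval (.inl b)) :=
    (hcU.mul hcη).integrableOn_compact hcomp
  have iUη2 : IntegrableOn (fun t => U t * deriv (deriv η) t) (G.interval (.inl b)) :=
    (hcU.mul hcη2).integrableOn_compact hcomp
  have iP1 : IntegrableOn (fun t => U t ^ (p - 1) * η t) (G.interval (.inl b)) :=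
    ((hcq (p - 1)).mul hcη).integrableOn_compact hcomp
  have iP : IntegrableOn (fun t => U t ^ p * η t) (G.interval (.inl b)) :=
    ((hcq p).mul hcη).integrableOn_compact hcomp
  have iD : IntegrableOn (fun t => U t ^ 2 * deriv ψ t ^ 2) (G.interval (.inl b)) :=
    ((hcU.pow 2).mul (hcψ'.pow 2)).integrableOn_compact hcomp
  have hmass : ∫ t in G.interval (.inl b), U t ^ 2 ≤ mass u := by
    simpa using integral_sq_le_mass u (.inl b)
  -- The equation tested with `η = ψ²`, both derivatives being moved onto `η`. The primitive is `u'
  -- η - u η'`, which vanishes at the endpoints because `η' = 2 ψ ψ'`.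
  have hparts : lam * (∫ t in G.interval (.inl b), U t * η t) -
      ρ * (∫ t in G.interval (.inl b), U t ^ (p - 1) * η t) -
      ∫ t in G.interval (.inl b), U t * deriv (deriv η) t = 0 := by
    have h := integral_interval_inl_eq_sub (G := G) b (F := fun t => v t * η t - U t * deriv η t)
      (F' := fun t => (lam * U t - ρ * U t ^ (p - 1)) * η t - U t * deriv (deriv η) t) ?_ ?_
    · have hψ0 : ψ 0 = 0 := hz 0 (by simp)
      have hψ1 : ψ (G.len b) = 0 := hz _ (by simp)
      have hη0 : η 0 = 0 := by simp [hη, hψ0]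
      have hη1 : η (G.len b) = 0 := by simp [hη, hψ1]
      rw [← integral_const_mul, ← integral_const_mul, ← integral_sub (iUη.const_mul lam)
        (iP1.const_mul ρ)]
      refine ((integral_sub ((iUη.const_mul lam).sub (iP1.const_mul ρ)) iUη2).symm.trans ?_).trans
        (h.trans (by simp [hη', hη0, hη1, hψ0, hψ1]))
      refine integral_congr_ae (ae_of_all _ fun t => ?_)
      simp only [Pi.sub_apply]
      ring
    · intro t ht
      have d1 := hu.hasDerivWithinAt ht
      have d2 := hu.hasDerivWithinAt_derivWithin ht
      have d3 := ((hη2.differentiable two_ne_zero) t).hasDerivAt.hasDerivWithinAt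
        (s := G.interval (.inl b))
      have d4 := ((hη1.differentiable one_ne_zero) t).hasDerivAt.hasDerivWithinAt
        (s := G.interval (.inl b))
      refine ((d2.fun_mul d3).fun_sub (d1.fun_mul d4)).congr_deriv ?_
      ring
    · exact (((continuousOn_const.mul hcU).sub (continuousOn_const.mul (hcq (p - 1)))).mul
        hcη).sub (hcU.mul hcη2)
  have b1 : ∫ t in G.interval (.inl b), U t ^ 2 * deriv ψ t ^ 2 ≤ M * mass u := by
    refine le_trans ?_ (mul_le_mul_of_nonneg_left hmass hM0)
    rw [← integral_const_mul]
    refine setIntegral_mono_on iD (iU2.const_mul M) hms fun t _ => ?_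
    rw [mul_comm]
    exact mul_le_mul_of_nonneg_right (hM1 t) (sq_nonneg _)
  have b2 : δ * ∫ t in G.interval (.inl b), U t ^ (p - 1) * η t ≤
      ∫ t in G.interval (.inl b), U t ^ p * η t := by
    rw [← integral_const_mul]
    refine setIntegral_mono_on (iP1.const_mul δ) iP hms fun t ht => ?_
    have hpos := hu.comp_pos ht
    rw [← hU] at hpos
    have e1 : U t ^ p = U t * U t ^ (p - 1) := by
      rw [mul_comm, ← Real.rpow_add_one hpos.ne']; ring_nf
    rw [e1, ← mul_assoc]
    have := hlow t ht
    have hη0 : 0 ≤ η t := sq_nonneg _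
    gcongr
  have b3 : δ * ∫ t in G.interval (.inl b), η t ≤ ∫ t in G.interval (.inl b), U t * η t := by
    rw [← integral_const_mul]
    refine setIntegral_mono_on ((hcη.integrableOn_compact hcomp).const_mul δ) iUη hms
      fun t ht => ?_
    exact mul_le_mul_of_nonneg_right (hlow t ht) (sq_nonneg _)
  -- The factor `δ ≤ u` turns `u` into `u²`, so the error is controlled by the mass, independently
  -- of `lam`.
  have b4 : δ * ∫ t in G.interval (.inl b), U t * deriv (deriv η) t ≤ M * mass u := by
    refine le_trans ?_ (mul_le_mul_of_nonneg_left hmass hM0)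
    rw [← integral_const_mul, ← integral_const_mul]
    refine setIntegral_mono_on (iUη2.const_mul δ) (iU2.const_mul M) hms fun t ht => ?_
    have h1 := hlow t ht
    have h2 := (abs_le.1 (hM2 t)).2
    have h3 : 0 < U t := hδ.trans_le h1
    calc δ * (U t * deriv (deriv η) t) ≤ δ * (U t * M) := by gcongr
      _ ≤ U t * (U t * M) := by gcongr
      _ = M * U t ^ 2 := by ring
  rw [integral_sub iD (iP.const_mul _), integral_const_mul]
  have c1 : lam * (δ ^ 2 * ∫ t in G.interval (.inl b), η t) - M * mass u ≤
      ρ * ∫ t in G.interval (.inl b), U t ^ p * η t := by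
    calc lam * (δ ^ 2 * ∫ t in G.interval (.inl b), η t) - M * mass u
        ≤ lam * (δ * ∫ t in G.interval (.inl b), U t * η t) -
          δ * ∫ t in G.interval (.inl b), U t * deriv (deriv η) t := by
          rw [pow_two, mul_assoc δ δ]
          gcongr
      _ = ρ * (δ * ∫ t in G.interval (.inl b), U t ^ (p - 1) * η t) := by
          linear_combination δ * hparts
      _ ≤ _ := by gcongr
  have c2 := mul_le_mul_of_nonneg_left c1 (by linarith : 0 ≤ p - 2)
  rw [← mul_assoc] at c2
  linarith

end MetricGraph

/-! ### Disjoint bumps, Morse index and the upper bound on the frequency. -/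

/-- Smooth bump functions with disjoint supports inside of an interval. -/
theorem exists_disjoint_bumps {l : ℝ} (hl : 0 < l) (n : ℕ) : ∃ ψ : Fin n → ℝ → ℝ,
    (∀ i, ContDiff ℝ 2 (ψ i)) ∧ (∀ i, tsupport (ψ i) ⊆ Ioo 0 l) ∧
    (∀ i j, i ≠ j → Disjoint (tsupport (ψ i)) (tsupport (ψ j))) ∧
    (∀ i, ∃ x ∈ Ioo 0 l, ψ i x ≠ 0) := by
  -- The centers `s, 2s, ..., n s` are at distance at least `s` from one another and from `0` and
  -- `l`, so the closed balls of radius `s / 3` are disjoint and interior.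
  set s : ℝ := l / (n + 1) with hs
  have hs0 : 0 < s := by positivity
  have hsl : s * (n + 1) = l := by rw [hs]; field_simp
  let f : ∀ i : Fin n, ContDiffBump (((i : ℕ) + 1 : ℝ) * s) := fun i =>
    ⟨s / 6, s / 3, by positivity, by linarith⟩
  have hsupp : ∀ i : Fin n, tsupport (f i : ℝ → ℝ) ⊆ Ioo 0 l := by
    intro i x hx
    rw [(f i).tsupport_eq, Real.closedBall_eq_Icc] at hx
    have h1 : (0 : ℝ) ≤ (i : ℕ) := Nat.cast_nonneg _
    have h2 : ((i : ℕ) + 1 : ℝ) ≤ n := by exact_mod_cast i.2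
    obtain ⟨hx1, hx2⟩ := hx
    change _ - s / 3 ≤ x at hx1
    change x ≤ _ + s / 3 at hx2
    constructor
    · nlinarith
    · nlinarith
  refine ⟨fun i => f i, fun i => (f i).contDiff, hsupp, fun i j hij => ?_, fun i => ?_⟩
  · rw [(f i).tsupport_eq, (f j).tsupport_eq]
    refine Metric.closedBall_disjoint_closedBall ?_
    change s / 3 + s / 3 < _
    rw [Real.dist_eq, ← sub_mul, abs_mul, abs_of_pos hs0]
    have h1 : (1 : ℝ) ≤ |((i : ℕ) + 1 : ℝ) - ((j : ℕ) + 1)| := by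
      have : (1 : ℤ) ≤ |((i : ℕ) : ℤ) - ((j : ℕ) : ℤ)| :=
        Int.one_le_abs (sub_ne_zero.2 (by exact_mod_cast Fin.val_ne_of_ne hij))
      rw [add_sub_add_right_eq_sub]
      exact_mod_cast this
    nlinarith
  · have h1 : (f i : ℝ → ℝ) (((i : ℕ) + 1 : ℝ) * s) = 1 :=
      (f i).one_of_mem_closedBall (Metric.mem_closedBall_self (f i).rIn_pos.le)
    have hne : (f i : ℝ → ℝ) (((i : ℕ) + 1 : ℝ) * s) ≠ 0 := by rw [h1]; exact one_ne_zero
    exact ⟨_, hsupp i (subset_tsupport _ hne), hne⟩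

theorem Finset.sq_sum_of_mul_eq_zero {ι : Type*} (s : Finset ι) (a : ι → ℝ)
    (h : ∀ i j, i ≠ j → a i * a j = 0) : (∑ i ∈ s, a i) ^ 2 = ∑ i ∈ s, a i ^ 2 := by
  rw [sq, Finset.sum_mul_sum]
  refine Finset.sum_congr rfl fun i hi => ?_
  rw [Finset.sum_eq_single_of_mem i hi fun j _ hj => h i j hj.symm, sq]

theorem HasCompactSupport.exists_abs_le {f : ℝ → ℝ} (hf : HasCompactSupport f)
    (hc : Continuous f) : ∃ M, ∀ t, |f t| ≤ M :=
  hf.exists_bound_of_continuous hc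

namespace MetricGraph

variable {V B H : Type*} {G : MetricGraph V B H}

variable (G) in
/-- The component of a function on an edge, as a linear map. -/
noncomputable def compLinear (e : B ⊕ H) : G.H1 →ₗ[ℝ] ℝ → ℝ where
  toFun u := G.comp u e
  map_add' u v := G.comp_add u v e
  map_smul' c u := G.comp_smul c u e

theorem comp_linearCombination {ι : Type*} [Fintype ι] (φ : ι → G.H1) (c : ι → ℝ) (e : B ⊕ H)
    (t : ℝ) : G.comp (Fintype.linearCombination ℝ φ c : G.H1) e t = ∑ i, c i * G.comp (φ i) e t := by
  have h : G.compLinear e (Fintype.linearCombination ℝ φ c) = ∑ i, c i • G.compLinear e (φ i) := by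
    simp [Fintype.linearCombination_apply]
  have h2 := congrFun h t
  simp only [Finset.sum_apply, Pi.smul_apply, smul_eq_mul] at h2
  exact h2

variable [Fintype B] [Fintype H] {p lam ρ : ℝ} {u : G.H1}

/-- Disjoint negative directions for the second variation bound the Morse index from below. -/
theorem IsPositiveSolution.le_morseIndex (hu : IsPositiveSolution p lam ρ (u : G.Point → ℝ))
    {b : B} {n : ℕ} {ψ : Fin n → ℝ → ℝ} (hψ : ∀ i, ContDiff ℝ 2 (ψ i))
    (hsupp : ∀ i, tsupport (ψ i) ⊆ Ioo 0 (G.len b))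
    (hdisj : ∀ i j, i ≠ j → Disjoint (tsupport (ψ i)) (tsupport (ψ j)))
    (hne : ∀ i, ∃ x ∈ Ioo 0 (G.len b), ψ i x ≠ 0)
    (hneg : ∀ i, ∫ t in G.interval (.inl b), (G.comp u (.inl b) t ^ 2 * deriv (ψ i) t ^ 2 -
        (p - 2) * ρ * (G.comp u (.inl b) t ^ p * ψ i t ^ 2)) < 0) :
    (n : ℕ∞) ≤ morseIndex p lam ρ u := by
  have hψ1 : ∀ i, ContDiff ℝ 1 (ψ i) := fun i => (hψ i).of_le one_le_two
  choose φ hφc hφ hφ0 using fun i => exists_localized u b (hψ1 i) (hsupp i)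
    ((hu.contDiffOn (.inl b)).of_le one_le_two)
  have hz : ∀ i t, t ∉ Ioo 0 (G.len b) → ψ i t = 0 := fun i t ht =>
    image_eq_zero_of_notMem_tsupport fun h => ht (hsupp i h)
  have hmul : ∀ i j, i ≠ j → ∀ t, ψ i t * ψ j t = 0 := by
    intro i j hij t
    by_cases h : t ∈ tsupport (ψ i)
    · rw [image_eq_zero_of_notMem_tsupport (Set.disjoint_left.1 (hdisj i j hij) h), mul_zero]
    · rw [image_eq_zero_of_notMem_tsupport h, zero_mul]
  have hmul' : ∀ i j, i ≠ j → ∀ t, deriv (ψ i) t * deriv (ψ j) t = 0 := by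
    intro i j hij t
    by_cases h : t ∈ tsupport (ψ i)
    · rw [Function.notMem_support.1 fun h' =>
        Set.disjoint_left.1 (hdisj i j hij) h (support_deriv_subset h'), mul_zero]
    · rw [Function.notMem_support.1 fun h' => h (support_deriv_subset h'), zero_mul]
  set Φ := Fintype.linearCombination ℝ φ with hΦ
  have hcomp : ∀ c, G.comp (Φ c : G.H1) (.inl b) =
      fun t => G.comp u (.inl b) t * ∑ i, c i * ψ i t := by
    intro c
    funext t
    rw [hΦ, comp_linearCombination, Finset.mul_sum]
    refine Finset.sum_congr rfl fun i _ => ?_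
    rw [hφ i]
    ring
  have hinj : Function.Injective Φ := by
    refine (injective_iff_map_eq_zero Φ).2 fun c hc => ?_
    funext i
    obtain ⟨x, hx, hxi⟩ := hne i
    have h := congrFun (hcomp c) x
    rw [hc] at h
    change G.comp (0 : G.Point → ℝ) (.inl b) x = _ at h
    rw [comp_zero, Finset.sum_eq_single i ?_ (by simp)] at h
    · have hpos := hu.comp_pos (e := .inl b) (Ioo_subset_Icc_self hx)
      rcases mul_eq_zero.1 h.symm with h | h
      · exact absurd h hpos.ne'
      · exact (mul_eq_zero.1 h).resolve_right hxi
    · intro j _ hj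
      have := (mul_eq_zero.1 (hmul j i hj x)).resolve_right hxi
      rw [this, mul_zero]
  -- Disjoint supports kill the cross terms of both `ψ` and `ψ'`: the form is diagonal on the span.
  have hQ : ∀ c, secondVariation p lam ρ u (Φ c) = ∑ i, c i ^ 2 *
      ∫ t in G.interval (.inl b), (G.comp u (.inl b) t ^ 2 * deriv (ψ i) t ^ 2 -
        (p - 2) * ρ * (G.comp u (.inl b) t ^ p * ψ i t ^ 2)) := by
    intro c
    have hsum : ContDiff ℝ 1 (fun t => ∑ i, c i * ψ i t) :=
      ContDiff.sum fun i _ => contDiff_const.mul (hψ1 i)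
    rw [hu.secondVariation_eq hsum (by simp [hz]) (by simp [hz]) (hcomp c)]
    · simp only [← integral_const_mul]
      rw [← integral_finsetSum]
      · refine integral_congr_ae (ae_of_all _ fun t => ?_)
        have hd : deriv (fun t => ∑ i, c i * ψ i t) t = ∑ i, c i * deriv (ψ i) t := by
          rw [deriv_fun_sum fun i _ =>
            (((hψ1 i).differentiable one_ne_zero) t).const_mul (c i)]
          refine Finset.sum_congr rfl fun i _ => ?_
          exact deriv_const_mul _ (((hψ1 i).differentiable one_ne_zero) t)
        simp only [hd]
        rw [Finset.sq_sum_of_mul_eq_zero _ _ fun i j hij => by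
            rw [mul_mul_mul_comm, hmul' i j hij, mul_zero],
          Finset.sq_sum_of_mul_eq_zero _ _ fun i j hij => by
            rw [mul_mul_mul_comm, hmul i j hij, mul_zero],
          Finset.mul_sum, Finset.mul_sum, Finset.mul_sum, ← Finset.sum_sub_distrib]
        refine Finset.sum_congr rfl fun i _ => ?_
        ring
      · intro i _
        have hcomp : IsCompact (G.interval (.inl b : B ⊕ H)) := isCompact_Icc
        have hcont : ContinuousOn (fun t => G.comp u (.inl b) t ^ 2 * deriv (ψ i) t ^ 2 -
            (p - 2) * ρ * (G.comp u (.inl b) t ^ p * ψ i t ^ 2)) (G.interval (.inl b)) :=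
          (((hu.contDiffOn (.inl b)).continuousOn.pow 2).mul
            (((hψ1 i).continuous_deriv le_rfl).continuousOn.pow 2)).sub
            (continuousOn_const.mul ((hu.continuousOn_rpow (.inl b) p).mul
              ((hψ1 i).continuous.continuousOn.pow 2)))
        have hint := hcont.integrableOn_compact hcomp (μ := volume)
        exact hint.const_mul _
    · intro e he
      funext t
      rw [hΦ, comp_linearCombination]
      simp [hφ0 _ e he]
  have hW : ∀ f ∈ LinearMap.range Φ, HasCompactSupport (f : G.Point → ℝ) ∧
      (f ≠ 0 → secondVariation p lam ρ u f < 0) := by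
    rintro _ ⟨c, rfl⟩
    refine ⟨?_, fun hc => ?_⟩
    · rw [hΦ, Fintype.linearCombination_apply]
      refine Finset.sum_induction _ (fun f : G.H1 => HasCompactSupport (f : G.Point → ℝ))
        (fun f g hf hg => hf.add hg) HasCompactSupport.zero fun i _ => ?_
      exact (hφc i).smul_left (f := fun _ => c i)
    · rw [hQ]
      have : ∃ i, c i ≠ 0 := by
        by_contra! h
        exact hc (by rw [show c = 0 from funext h, map_zero])
      obtain ⟨i, hi⟩ := this
      exact Finset.sum_neg' (fun j _ => mul_nonpos_of_nonneg_of_nonpos (sq_nonneg _) (hneg j).le)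
        ⟨i, Finset.mem_univ i, mul_neg_of_pos_of_neg (by positivity) (hneg i)⟩
  refine le_trans ?_ (le_iSup (fun W : {W : Submodule ℝ G.H1 // ∀ φ ∈ W,
      HasCompactSupport (φ : G.Point → ℝ) ∧ (φ ≠ 0 → secondVariation p lam ρ u φ < 0)} =>
    Cardinal.toENat (Module.rank ℝ W.1)) ⟨LinearMap.range Φ, hW⟩)
  have hfin := (LinearEquiv.ofInjective Φ hinj).finrank_eq
  simp only [Module.finrank_fintype_fun_eq_card, Fintype.card_fin] at hfin
  simp only
  rw [← Module.finrank_eq_rank, ← hfin, Cardinal.toENat_nat]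

variable (G) in
/-- A solution with large frequency and bounded away from zero on an edge has a large Morse
index. -/
theorem eventually_le_morseIndex (hp : 2 < p) (μ : ℝ) (b : B) {δ : ℝ} (hδ : 0 < δ) (n : ℕ) :
    ∀ᶠ lam in atTop, ∀ ρ, 0 ≤ ρ → ∀ u : G.H1, IsPositiveSolution p lam ρ (u : G.Point → ℝ) →
      mass u = μ → (∀ t ∈ G.interval (.inl b), δ ≤ G.comp u (.inl b) t) →
      (n : ℕ∞) ≤ morseIndex p lam ρ u := by
  obtain ⟨ψ, hψ, hsupp, hdisj, hne⟩ := exists_disjoint_bumps (G.len_pos b) n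
  have hcs : ∀ i, HasCompactSupport (ψ i) := fun i =>
    isCompact_Icc.of_isClosed_subset (isClosed_tsupport _) ((hsupp i).trans Ioo_subset_Icc_self)
  have hcd : ∀ {f : ℝ → ℝ}, ContDiff ℝ 2 f → ContDiff ℝ 1 (deriv f) := by
    intro f hf
    have : ContDiff ℝ (1 + 1) f := by norm_num; exact hf
    exact (contDiff_succ_iff_deriv.1 this).2.2
  have hM : ∀ i, ∃ M, (∀ t, deriv (ψ i) t ^ 2 ≤ M) ∧
      ∀ t, |deriv (deriv fun s => ψ i s ^ 2) t| ≤ M := by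
    intro i
    obtain ⟨M1, h1⟩ := (hcs i).deriv.exists_abs_le (hcd (hψ i)).continuous
    have hs2 : HasCompactSupport fun s => ψ i s ^ 2 :=
      (hcs i).comp_left (g := fun x : ℝ => x ^ 2) (by simp)
    obtain ⟨M2, h2⟩ := hs2.deriv.deriv.exists_abs_le
      ((hcd ((hψ i).pow 2)).continuous_deriv le_rfl)
    refine ⟨max (M1 ^ 2) M2, fun t => le_max_of_le_left ?_, fun t => le_max_of_le_right (h2 t)⟩
    exact sq_le_sq' (abs_le.1 (h1 t)).1 (abs_le.1 (h1 t)).2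
  choose M hM1 hM2 using hM
  have hJ : ∀ i, 0 < ∫ t in G.interval (.inl b), ψ i t ^ 2 := by
    intro i
    obtain ⟨x, hx, hxi⟩ := hne i
    have h : G.interval (.inl b : B ⊕ H) = Icc 0 (G.len b) := rfl
    rw [h, integral_Icc_eq_integral_Ioc, ← intervalIntegral.integral_of_le (G.len_pos b).le]
    refine intervalIntegral.integral_pos (G.len_pos b) ((hψ i).continuous.pow 2).continuousOn
      (fun t _ => sq_nonneg _) ⟨x, Ioo_subset_Icc_self hx, by positivity⟩
  have hev : ∀ᶠ lam in atTop, ∀ i, M i * μ - (p - 2) *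
      (lam * (δ ^ 2 * ∫ t in G.interval (.inl b), ψ i t ^ 2) - M i * μ) < 0 := by
    refine eventually_all.2 fun i => ?_
    have hpos : 0 < δ ^ 2 * ∫ t in G.interval (.inl b), ψ i t ^ 2 := mul_pos (by positivity) (hJ i)
    have hp' : 0 < p - 2 := by linarith
    filter_upwards [eventually_gt_atTop
      ((M i * μ / (p - 2) + M i * μ) / (δ ^ 2 * ∫ t in G.interval (.inl b), ψ i t ^ 2))] with lam hl
    rw [div_lt_iff₀ hpos] at hl
    have h2 := mul_lt_mul_of_pos_left hl hp'
    rw [mul_add, mul_div_cancel₀ _ hp'.ne'] at h2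
    linarith
  filter_upwards [hev, eventually_ge_atTop 0] with lam h1 h2 ρ hρ u hu hmass hlow
  refine hu.le_morseIndex hψ hsupp hdisj hne fun i => lt_of_le_of_lt
    (hu.integral_secondVariation_le hp.le hρ h2 hδ hlow (hψ i) (hsupp i) (hM1 i) (hM2 i)) ?_
  rw [hmass]
  exact h1 i

variable (G) in
/-- The frequency of a solution is bounded from above in terms of its energy and Morse index. -/
theorem exists_lam_le [Finite V] (hp : 6 < p) {μ : ℝ} (hμ : 0 < μ) (k : ℕ) (C : ℝ) :
    ∃ L, ∀ lam ρ, 0 ≤ ρ → ∀ u : G.H1, IsPositiveSolution p lam ρ (u : G.Point → ℝ) →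
      mass u = μ → |energy p ρ u| ≤ C → morseIndex p lam ρ u ≤ k → lam ≤ L := by
  set κ := μ * (p - 6) / (4 * (p - 2)) with hκ
  have hκ0 : 0 < κ := by
    have h1 : 0 < p - 6 := by linarith
    have h2 : 0 < p - 2 := by linarith
    positivity
  -- Without bounded edges a large `lam` is contradictory at once, since `exists_firstIntegral_le`
  -- would produce one.
  rcases isEmpty_or_nonempty B with hB | hB
  · refine ⟨max 0 (C * (p + 2) / (p - 2) / κ), fun lam ρ hρ u hu hmass hE _ => ?_⟩
    by_contra! h
    rw [max_lt_iff, div_lt_iff₀ hκ0] at h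
    obtain ⟨b, -⟩ := hu.exists_firstIntegral_le hp hmass hE h.2.le (mul_pos h.1 hκ0)
    exact hB.false b
  have hcard : (0 : ℝ) < Fintype.card B := by exact_mod_cast Fintype.card_pos
  -- On the selected edge `lam u²/2 ≥ -c ≥ lam κ / (len b * card B)`. Dividing by `lam` gives this
  -- lower bound for `u`, free of `lam`.
  have hδ : ∀ b, 0 < √(2 * κ / (G.len b * Fintype.card B)) := fun b => by
    have := G.len_pos b
    positivity
  -- The selected edge depends on the solution, so one threshold must serve all of the finitely many
  -- edges. The index `k + 1` is what contradicts the Morse bound.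
  obtain ⟨L, hL⟩ := eventually_atTop.1 ((eventually_all.2 fun b =>
    eventually_le_morseIndex G (by linarith : 2 < p) μ b (hδ b) (k + 1)).and
    ((eventually_gt_atTop 0).and (eventually_gt_atTop (C * (p + 2) / (p - 2) / κ))))
  refine ⟨L, fun lam ρ hρ u hu hmass hE hk => ?_⟩
  by_contra! h
  obtain ⟨h1, h2, h3⟩ := hL lam h.le
  rw [div_lt_iff₀ hκ0] at h3
  obtain ⟨b, c, hc, hcb⟩ := hu.exists_firstIntegral_le hp hmass hE h3.le (mul_pos h2 hκ0)
  have h4 := (h1 b ρ hρ u hu hmass fun t ht => ?_).trans hk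
  · exact absurd (Nat.cast_le.1 h4) (by simp)
  · have hpos := hu.comp_pos ht
    refine Real.sqrt_le_iff.2 ⟨hpos.le, ?_⟩
    have hlen := G.len_pos b
    rw [div_le_iff₀ (by positivity)]
    have h5 : 0 ≤ ρ / p * G.comp u (.inl b) t ^ p := by
      have : 0 < p := by linarith
      positivity
    have h6 : lam / 2 * G.comp u (.inl b) t ^ 2 ≥ -c := by
      have := hc t ht
      nlinarith [sq_nonneg (derivWithin (G.comp u (.inl b)) (G.interval (.inl b)) t)]
    have h7 : lam * κ ≤ lam / 2 * G.comp u (.inl b) t ^ 2 * (G.len b * Fintype.card B) := by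
      have := mul_le_mul_of_nonneg_right h6 (by positivity : 0 ≤ G.len b * Fintype.card B)
      linarith
    have h8 : lam * (2 * κ) ≤ lam * (G.comp u (.inl b) t ^ 2 * (G.len b * Fintype.card B)) := by
      linarith
    exact le_of_mul_le_mul_left h8 h2

end MetricGraph

/-! ### A priori bounds and the Palais–Smale property. -/

theorem exists_forall_le_of_eventually_le {f : ℕ → ℝ} {C : ℝ} (h : ∀ᶠ n in atTop, f n ≤ C) :
    ∃ C', ∀ n, f n ≤ C' := by
  obtain ⟨C', hC'⟩ := (isBoundedUnder_of_eventually_le h).bddAbove_range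
  exact ⟨C', fun n => hC' (mem_range_self n)⟩

namespace MetricGraph

variable {V B H : Type*} {G : MetricGraph V B H} [Fintype B] [Fintype H] {p lam ρ : ℝ} {u : G.H1}

theorem h1Norm_sq (u : G.H1) :
    h1Norm u ^ 2 = (∑ e, ∫ t in G.interval e, |deriv (G.comp u e) t| ^ 2) + mass u := by
  rw [h1Norm, Real.sq_sqrt, Finset.sum_add_distrib, mass]
  exact Finset.sum_nonneg fun e _ =>
    add_nonneg (integral_nonneg fun t => by positivity) (integral_nonneg fun t => by positivity)

/-- Elimination of `∫|u|^p` between the energy and the Nehari identity. It converts bounds on `lam`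
into bounds in `H¹`, and its nonnegativity bounds `lam` from below. -/
theorem IsPositiveSolution.integral_deriv_sq_eq [Finite V] (hp : 2 < p)
    (hu : IsPositiveSolution p lam ρ (u : G.Point → ℝ)) :
    ∑ e, ∫ t in G.interval e, |deriv (G.comp u e) t| ^ 2 =
      (2 * p * energy p ρ u + 2 * lam * mass u) / (p - 2) := by
  have h1 := hu.nehari hp.le
  rw [energy]
  generalize (∑ e, ∫ t in G.interval e, |deriv (G.comp u e) t| ^ 2) = A at *
  generalize (∑ e, ∫ t in G.interval e, |G.comp u e t| ^ p) = P at *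
  have h2 : p - 2 ≠ 0 := by linarith
  have h3 : p ≠ 0 := by linarith
  field_simp
  linear_combination -2 * h1

theorem IsPositiveSolution.neg_le_lam [Finite V] (hp : 2 < p) {μ C : ℝ} (hμ : 0 < μ)
    (hu : IsPositiveSolution p lam ρ (u : G.Point → ℝ)) (hmass : mass u = μ)
    (hE : |energy p ρ u| ≤ C) : -(p * C / μ) ≤ lam := by
  have h1 := hu.integral_deriv_sq_eq hp
  have h2 : 0 ≤ ∑ e, ∫ t in G.interval e, |deriv (G.comp u e) t| ^ 2 :=
    Finset.sum_nonneg fun e _ => integral_nonneg fun t => by positivity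
  have hp' : 0 < p - 2 := by linarith
  have hp0 : 0 < p := by linarith
  rw [h1, hmass] at h2
  have h3 := mul_nonneg h2 hp'.le
  rw [div_mul_cancel₀ _ hp'.ne'] at h3
  have h4 := mul_le_mul_of_nonneg_left (abs_le.1 hE).2 hp0.le
  rw [neg_le_iff_add_nonneg, ← sub_neg_eq_add, sub_nonneg, neg_le, le_div_iff₀ hμ]
  linarith

/-- A bound for the derivative of the nonlinear term. -/
theorem IsPositiveSolution.abs_integral_rpow_mul_le (hp : 3 ≤ p)
    (hu : IsPositiveSolution p lam ρ (u : G.Point → ℝ)) {K N : ℝ}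
    (hK : ∀ (φ : G.H1) (e : B ⊕ H), ∀ t ∈ G.interval e, |G.comp φ e t| ≤ K * h1Norm φ)
    (hN : ∀ e : B ⊕ H, ∀ t ∈ G.interval e, |G.comp u e t| ≤ N) (φ : G.H1) :
    |∑ e, ∫ t in G.interval e, G.comp u e t ^ (p - 1) * G.comp φ e t| ≤
      N ^ (p - 3) * K * mass u * h1Norm φ := by
  have h : ∀ e : B ⊕ H, |∫ t in G.interval e, G.comp u e t ^ (p - 1) * G.comp φ e t| ≤
      N ^ (p - 3) * (K * h1Norm φ) * ∫ t in G.interval e, |G.comp u e t| ^ 2 := by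
    intro e
    rw [← integral_const_mul, ← Real.norm_eq_abs]
    refine norm_integral_le_of_norm_le ((memH1_comp u e).integrable_sq.const_mul _) ?_
    filter_upwards [ae_restrict_mem (measurableSet_interval e)] with t ht
    have hpos := hu.comp_pos ht
    -- Two powers of `u` are kept for the mass. The other `p - 3` and `φ` are estimated in the sup
    -- norm.
    have e1 : G.comp u e t ^ (p - 1) = G.comp u e t ^ (p - 3) * G.comp u e t ^ 2 := by
      rw [← Real.rpow_natCast, ← Real.rpow_add hpos]; norm_num; ring_nf
    have h1 := hN e t ht
    have h2 := hK φ e t ht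
    rw [abs_of_pos hpos] at h1 ⊢
    rw [norm_mul, e1, norm_mul, Real.norm_of_nonneg (Real.rpow_nonneg hpos.le _),
      Real.norm_of_nonneg (sq_nonneg _), Real.norm_eq_abs, mul_right_comm]
    have hp' : 0 ≤ p - 3 := by linarith
    have hN0 : 0 ≤ N := hpos.le.trans h1
    gcongr
  refine (Finset.abs_sum_le_sum_abs _ _).trans ((Finset.sum_le_sum fun e _ => h e).trans ?_)
  rw [← Finset.mul_sum, ← mass]
  exact (by ring : N ^ (p - 3) * (K * h1Norm φ) * mass u = _).le

/-- The constrained differential of `E_1` at a solution of the equation with parameter `ρ`. -/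
theorem IsPositiveSolution.hasLineDerivAt_of_isTangent [Finite V] (hp : 2 ≤ p)
    (hu : IsPositiveSolution p lam ρ (u : G.Point → ℝ)) {φ : G.H1} (hφ : IsTangent u φ) :
    HasLineDerivAt ℝ (energy (G := G) p 1)
      ((ρ - 1) * ∑ e, ∫ t in G.interval e, G.comp u e t ^ (p - 1) * G.comp φ e t) u φ := by
  refine (hasLineDerivAt_energy (ρ := 1) hp u φ).congr_deriv ?_
  -- Tangency removes the `lam` term, so `∫ u' φ' = ρ ∫ u^(p-1) φ` and only `ρ - 1` survives in the
  -- differential of `E_1`.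
  have h := hu.weak hp φ
  rw [IsTangent] at hφ
  rw [hφ, mul_zero, add_zero] at h
  have h1 : ∀ e, ∫ t in G.interval e, |G.comp u e t| ^ (p - 2) * G.comp u e t * G.comp φ e t =
      ∫ t in G.interval e, G.comp u e t ^ (p - 1) * G.comp φ e t := fun e =>
    setIntegral_congr_fun (measurableSet_interval e) fun t ht => by
      have hpos := hu.comp_pos ht
      simp only [abs_of_pos hpos, ← Real.rpow_add_one hpos.ne']
      ring_nf
  simp only [h1, h]
  ring

end MetricGraph

theorem proposition5p1 {V B H : Type*} [Finite V] [Fintype B] [Fintype H]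
    (G : MetricGraph V B H) [ConnectedSpace G.Point]
    (p : ℝ) (hp : 6 < p) (μ : ℝ) (hμ : 0 < μ) (k : ℕ)
    (ρ lam : ℕ → ℝ) (u : ℕ → G.H1)
    (hρ : Filter.Tendsto ρ Filter.atTop (nhds 1))
    (hsol : ∀ n, MetricGraph.IsPositiveSolution p (lam n) (ρ n) (u n : G.Point → ℝ))
    (hmass : ∀ n, MetricGraph.mass (u n) = μ)
    (hmorse : ∀ n, MetricGraph.morseIndex p (lam n) (ρ n) (u n) ≤ k)
    (henergy : ∃ C, ∀ n, |MetricGraph.energy p (ρ n) (u n)| ≤ C) :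
    (∃ C, ∀ n, |lam n| ≤ C) ∧
    (∃ C, ∀ n, MetricGraph.h1Norm (u n) ≤ C) ∧
    MetricGraph.IsConstrainedPalaisSmale (MetricGraph.energy (G := G) p 1) μ u := by
  obtain ⟨C, hC⟩ := henergy
  have hp2 : 2 < p := by linarith
  have hp2' : 0 < p - 2 := by linarith
  -- This gives the sign `ρ ≥ 0` needed for the bound on `lam`, and lets `ρ ∫|u|^p` control
  -- `∫|u|^p`. The finitely many other indices only enlarge the constants.
  have hρhalf : ∀ᶠ n in atTop, 1 / 2 ≤ ρ n := hρ.eventually (Ici_mem_nhds (by norm_num))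
  obtain ⟨L, hL⟩ := MetricGraph.exists_lam_le G hp hμ k C
  obtain ⟨Λ, hΛ⟩ := exists_forall_le_of_eventually_le (f := lam) (C := L)
    (hρhalf.mono fun n hn => hL _ _ (by linarith) _ (hsol n) (hmass n) (hC n) (hmorse n))
  have hderiv : ∀ n, ∑ e, ∫ t in G.interval e, |deriv (G.comp (u n) e) t| ^ 2 ≤
      (2 * p * C + 2 * Λ * μ) / (p - 2) := by
    intro n
    rw [(hsol n).integral_deriv_sq_eq hp2, hmass n]
    have h1 := (abs_le.1 (hC n)).2
    have h2 := hΛ n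
    gcongr
  have hnorm : ∀ n, MetricGraph.h1Norm (u n) ≤ √((2 * p * C + 2 * Λ * μ) / (p - 2) + μ) := by
    intro n
    refine Real.le_sqrt_of_sq_le ?_
    rw [MetricGraph.h1Norm_sq, hmass n]
    linarith [hderiv n]
  obtain ⟨K, hK0, hK⟩ := MetricGraph.exists_abs_comp_le G
  refine ⟨⟨max Λ (p * C / μ), fun n => abs_le.2 ⟨?_, (hΛ n).trans (le_max_left _ _)⟩⟩,
    ⟨_, hnorm⟩, hmass, ?_, fun ε hε => ?_⟩
  · exact (neg_le_neg (le_max_right _ _)).trans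
      ((hsol n).neg_le_lam hp2 hμ (hmass n) (hC n))
  · refine exists_forall_le_of_eventually_le (f := fun n => |MetricGraph.energy p 1 (u n)|)
      (C := (1 / 2) * ((2 * p * C + 2 * Λ * μ) / (p - 2)) +
        (1 / p) * (2 * ((2 * p * C + 2 * Λ * μ) / (p - 2) + Λ * μ))) ?_
    filter_upwards [hρhalf] with n hn
    have h1 := (hsol n).nehari hp2.le
    have h2 := hderiv n
    have hA : 0 ≤ ∑ e, ∫ t in G.interval e, |deriv (G.comp (u n) e) t| ^ 2 :=
      Finset.sum_nonneg fun e _ => integral_nonneg fun t => by positivity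
    have hP : 0 ≤ ∑ e, ∫ t in G.interval e, |G.comp (u n) e t| ^ p :=
      Finset.sum_nonneg fun e _ => integral_nonneg fun t => by positivity
    have h3 := mul_le_mul_of_nonneg_right (hΛ n) hμ.le
    rw [hmass n] at h1
    rw [MetricGraph.energy]
    generalize (∑ e, ∫ t in G.interval e, |deriv (G.comp (u n) e) t| ^ 2) = A at *
    generalize (∑ e, ∫ t in G.interval e, |G.comp (u n) e t| ^ p) = P at *
    have hp0 : 0 < p := by linarith
    -- `P ≤ 2 ρ P = 2 (A + lam μ)` by the Nehari identity and `ρ ≥ 1/2`.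
    have h4 : P ≤ 2 * ((2 * p * C + 2 * Λ * μ) / (p - 2) + Λ * μ) := by
      have := mul_le_mul_of_nonneg_right hn hP
      linarith
    calc |1 / 2 * A - 1 / p * P| ≤ 1 / 2 * A + 1 / p * P := by
          refine (abs_sub _ _).trans ?_
          rw [abs_of_nonneg (by positivity), abs_of_nonneg (by positivity)]
      _ ≤ _ := by gcongr
  -- `N` bounds all `u n` in the sup norm, so `D` bounds the functional `φ ↦ ∫ u^(p-1) φ` uniformly
  -- in `n`.
  · set N := K * √((2 * p * C + 2 * Λ * μ) / (p - 2) + μ)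
    set D := N ^ (p - 3) * K * μ
    have hD : Tendsto (fun n => |ρ n - 1| * D) atTop (𝓝 0) := by
      have := ((hρ.sub_const 1).abs).mul_const D
      simpa using this
    filter_upwards [hD.eventually (Iic_mem_nhds hε)] with n hn φ hφ
    refine ⟨_, (hsol n).hasLineDerivAt_of_isTangent hp2.le hφ, ?_⟩
    have h1 := (hsol n).abs_integral_rpow_mul_le (by linarith) hK (N := N) (fun e t ht =>
      (hK (u n) e t ht).trans (mul_le_mul_of_nonneg_left (hnorm n) hK0)) φ
    rw [hmass n] at h1
    rw [abs_mul]
    calc _ ≤ |ρ n - 1| * (D * MetricGraph.h1Norm φ) := by gcongr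
      _ = |ρ n - 1| * D * MetricGraph.h1Norm φ := by ring
      _ ≤ _ := mul_le_mul_of_nonneg_right hn (MetricGraph.h1Norm_nonneg φ)
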